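/- **Theorem 3.3.** For a field $E$ let $E_s$ be a separable closure of $E$ and $G(E)=\mathrm{Gal}(E_s/E)$ its absolute Galois group, with the Krull topology. If $E\subseteq E'\subseteq E_s$, then $E_s$ is also a separable closure of $E'$ and $G(E')=\mathrm{Gal}(E_s/E')$ is regarded as a closed subgroup of $G(E)$. A profinite group $G$ is the *free product* of closed subgroups $G_1,\dots,G_n$ if these generate $G$ as a topological group and, for every profinite group $H$ and all continuous homomorphisms $\eta_i\colon G_i\to H$ $(i=1,\dots,n)$, there is a unique continuous homomorphism $\eta\colon G\to H$ with $\eta|_{G_i}=\eta_i$ for $i=1,\dots,n$. Let $K$ be a field and let $K_1,\dots,K_n$ be fields with $K\subseteq K_i\subseteq K_s$ (that is, $K_i/K$ is separable algebraic) and $\bigcap_{i=1}^n K_i=K$ (for $n=0$ the intersection, taken in $K_s$, is $K_s$). Then there are a field extension $F$ of $K$, a separable closure $F_s$ of $F$ containing $K_s$ (compatibly over $K$), and fields $F_1,\dots,F_n$ with $F\subseteq F_i\subseteq F_s$, such that: 1. $\mathrm{card}(F)=\max(\aleph_0,\mathrm{card}(K))$; 2. each $F_i/F$ is separable algebraic,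 and $\bigcap_{i=1}^n F_i=F$ (for $n=0$ the intersection is $F_s$); 3. for each $i$, $K_i\subseteq F_i$ and the restriction map $G(F_i)\to G(K_i)$, $\sigma\mapsto\sigma|_{K_s}$, is bijective; 4. $G(F)$ is the free product of its closed subgroups $G(F_1),\dots,G(F_n)$. -/

import Mathlib

open scoped Cardinal

universe u

/-- Given extensions `K ⊆ Ks ⊆ Fs` and `K ⊆ F ⊆ Fs` with `Ks / K` normal, the restriction map
`Gal(Fs/F) → Gal(Ks/K)`, `σ ↦ σ|_Ks`. -/
noncomputable def absGalRes (K Ks F Fs : Type u) [Field K] [Field Ks] [Field F] [Field Fs]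
    [Algebra K Ks] [Algebra F Fs] [Algebra K F] [Algebra K Fs] [Algebra Ks Fs]
    [IsScalarTower K F Fs] [IsScalarTower K Ks Fs] [Normal K Ks] :
    Gal(Fs/F) →* Gal(Ks/K) :=
  (AlgEquiv.restrictNormalHom Ks).comp (AlgEquiv.restrictScalarsHom K)

/-- `absGalRes` is indeed restriction: after embedding `Ks` into `Fs`, the automorphism
`absGalRes σ` acts on `Ks` as `σ`. -/
theorem algebraMap_absGalRes (K Ks F Fs : Type u) [Field K] [Field Ks] [Field F] [Field Fs]
    [Algebra K Ks] [Algebra F Fs] [Algebra K F] [Algebra K Fs] [Algebra Ks Fs]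
    [IsScalarTower K F Fs] [IsScalarTower K Ks Fs] [Normal K Ks] (σ : Gal(Fs/F)) (x : Ks) :
    algebraMap Ks Fs (absGalRes K Ks F Fs σ x) = σ (algebraMap Ks Fs x) :=
  AlgEquiv.restrictNormal_commutes (σ.restrictScalars K) Ks x

/-- The profinite group `G` is the (internal) free product, in the category of profinite groups,
of its subgroups `H 1, …, H n`: they are closed, they generate `G` as a topological group, and
every family of continuous homomorphisms from the `H i` into a profinite group `P` is the family
of restrictions of a unique continuous homomorphism `G → P`. -/
structure IsProfiniteFreeProduct {G : Type u} [Group G] [TopologicalSpace G]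
    [IsTopologicalGroup G] [CompactSpace G] [TotallyDisconnectedSpace G]
    {n : ℕ} (H : Fin n → Subgroup G) : Prop where
  isClosed : ∀ i, IsClosed (H i : Set G)
  generate : (⨆ i, H i).topologicalClosure = ⊤
  existsUnique_lift : ∀ (P : ProfiniteGrp.{u}) (η : ∀ i, H i →ₜ* P),
    ∃! f : G →ₜ* P, ∀ (i : Fin n) (g : H i), f (g : G) = η i g

/-! Let G be the profinite free product of the groups G(K_i), and let π : G → G(K) be induced by the
inclusions. It suffices to let G act faithfully, with open stabilizers, on a separably closed field
Ω containing K_s so that K_s is acted on through π. For F = Ω^G, Artin's theorem in profinite form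
(`bijective_toGalFixedSubfield`) gives G(F) = G. The factors of G cut out the F_i, restriction to
K_s inverts G(K_i) → G(F_i), and the F_i intersect in F because the factors generate.

G is realized inside a product of finite symmetric groups, so it acts faithfully on E =
K_s(X_{d,y}), by permuting variables and through π on coefficients. Take Ω = E_s. The action must be
lifted from E to Ω, that is, to Gal(Ω/E^G). By the universal property of G a lift over each factor
is enough, and a lift so obtained stays faithful.

For a factor H = G(K_i), which really is a subgroup of G(K), Galois descent supplies a K_s-linear
change of variables after which H acts on coefficients alone (`exists_straighten`). Such an action
extends to Hahn series over the algebraic closure of K_s with exponents in a divisible ordered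
group, an algebraically closed field (`HahnSeries.isAlgClosed`). Ω embeds there over E and, being
normal over E^G, is stable under H. Stabilizers of Hahn series need only be closed, but on elements
algebraic over E^G they also have finite index, hence are open (`exists_lift_sepClosure`). -/

open scoped Topology

/-! ### Algebraic closedness of Hahn series fields -/

namespace HahnSeries

section AlgClosed

variable {Γ k M Γ₀ : Type*} [AddCommGroup Γ] [LinearOrder Γ] [IsOrderedAddMonoid Γ] [Field k]
  [Field M] [LinearOrderedCommGroupWithZero Γ₀]

theorem orderTop_add_orderTop_inv {a : k⟦Γ⟧} (h : a ≠ 0) : a.orderTop + a⁻¹.orderTop = 0 := by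
  rw [← orderTop_mul, mul_inv_cancel₀ h, orderTop_one]

/-- The valuation ring of Hahn series of nonnegative order. -/
def orderSubring (Γ k : Type*) [AddCommGroup Γ] [LinearOrder Γ] [IsOrderedAddMonoid Γ] [Field k] :
    ValuationSubring k⟦Γ⟧ where
  carrier := {f | 0 ≤ f.orderTop}
  mul_mem' {a b} ha hb := by
    simp only [Set.mem_ofPred_eq] at *
    rw [orderTop_mul]
    exact add_nonneg ha hb
  one_mem' := by simp
  add_mem' {a b} ha hb := by
    simp only [Set.mem_ofPred_eq] at *
    exact (le_min ha hb).trans min_orderTop_le_orderTop_add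
  zero_mem' := by simp
  neg_mem' {a} ha := by simpa using ha
  mem_or_inv_mem' a := by
    by_cases h : a = 0
    · simp [h]
    rcases le_total 0 a.orderTop with h0 | h0
    · exact Or.inl h0
    · right
      have := orderTop_add_orderTop_inv h
      by_contra h1
      simp only [Set.mem_ofPred_eq, not_le] at h1
      have := add_lt_of_nonpos_of_lt h0 h1
      simp_all

theorem mem_orderSubring {f : k⟦Γ⟧} : f ∈ orderSubring Γ k ↔ 0 ≤ f.orderTop := by
  change f ∈ {f : k⟦Γ⟧ | 0 ≤ f.orderTop} ↔ _
  simp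

/-- A valuation on an extension of the field of Hahn series that extends the order valuation. -/
structure ExtendsOrder (φ : k⟦Γ⟧ →+* M) (w : Valuation M Γ₀) : Prop where
  le_one : ∀ f, 0 ≤ f.orderTop → w (φ f) ≤ 1
  lt_one : ∀ f, 0 < f.orderTop → w (φ f) < 1

/-- Chevalley: some valuation ring of `M` dominates the image of the local ring of series of
nonnegative order. Domination is what makes the second inequality strict. -/
theorem exists_extendsOrder (φ : k⟦Γ⟧ →+* M) :
    ∃ B : ValuationSubring M, ExtendsOrder φ B.valuation := by
  let ψ : orderSubring Γ k →+* M := φ.comp (orderSubring Γ k).subtype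
  obtain ⟨B, hB, hloc⟩ := (LocalSubring.range ψ).exists_le_valuationSubring
  have hle : ∀ f, 0 ≤ f.orderTop → φ f ∈ (LocalSubring.range ψ).toSubring :=
    fun f hf => ⟨⟨f, mem_orderSubring.2 hf⟩, rfl⟩
  have key : ∀ f, 0 ≤ f.orderTop → B.valuation (φ f) ≤ 1 := fun f hf =>
    (B.valuation_le_one_iff _).2 (hB (hle f hf))
  refine ⟨B, key, fun f hf => lt_of_le_of_ne (key f hf.le) fun h1 => ?_⟩
  have hu : IsUnit (Subring.inclusion hB ⟨φ f, hle f hf.le⟩) := by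
    have := (B.valuation_eq_one_iff ⟨φ f, hB (hle f hf.le)⟩).2 h1
    exact this
  obtain ⟨⟨_, ⟨g, hg⟩, rfl⟩, hg'⟩ := isUnit_iff_exists_inv.1 (hloc.1 _ hu)
  have h2 : φ (f * g) = φ 1 := by
    rw [map_mul, map_one]; exact congrArg Subtype.val hg'
  have h3 := congrArg orderTop (φ.injective h2)
  rw [orderTop_mul, orderTop_one] at h3
  exact (add_pos_of_pos_of_nonneg hf (mem_orderSubring.1 hg)).ne' h3

theorem single_mul_single_neg_mul (δ : Γ) (f : k⟦Γ⟧) :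
    single δ 1 * (single (-δ) 1 * f) = f := by
  rw [← mul_assoc, single_mul_single]; simp

theorem orderTop_single_mul (δ : Γ) (f : k⟦Γ⟧) :
    (single δ 1 * f).orderTop = δ + f.orderTop := by
  rw [orderTop_mul, orderTop_single one_ne_zero]

theorem orderTop_sub_C_coeff_zero {f : k⟦Γ⟧} (hf : 0 ≤ f.orderTop) :
    0 < (f - C (f.coeff 0)).orderTop := by
  obtain ⟨g, hg⟩ : ∃ g, g = f - C (f.coeff 0) := ⟨_, rfl⟩
  rw [← hg]
  by_contra h
  by_cases h0 : g = 0
  · simp [h0] at h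
  have h1 := coeff_order_eq_zero.not.2 h0
  rw [← order_eq_orderTop_of_ne_zero h0] at h
  norm_cast at h
  rcases (not_lt.1 h).eq_or_lt with h2 | h2
  · rw [h2, hg, coeff_sub, C_apply, coeff_single_same, sub_self] at h1
    exact h1 rfl
  · rw [hg, coeff_sub, ← hg, C_apply, coeff_single_of_ne h2.ne, sub_zero] at h1
    exact h1 (coeff_eq_zero_of_lt_orderTop (lt_of_lt_of_le (by exact_mod_cast h2) hf))

namespace ExtendsOrder

variable {φ : k⟦Γ⟧ →+* M} {w : Valuation M Γ₀} (hw : ExtendsOrder φ w)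
include hw

theorem lt_single {f : k⟦Γ⟧} {δ : Γ} (hf : (δ : WithTop Γ) < f.orderTop) :
    w (φ f) < w (φ (single δ 1)) := by
  have h1 : 0 < (single (-δ) (1 : k) * f).orderTop := by
    rw [orderTop_single_mul]
    by_cases h0 : f = 0
    · simp [h0]
    · rw [← order_eq_orderTop_of_ne_zero h0] at hf ⊢
      norm_cast at hf ⊢
      simpa [neg_add_eq_sub] using hf
  have h2 := hw.lt_one _ h1
  have h3 : 0 < w (φ (single δ 1)) := by simp [zero_lt_iff]
  calc w (φ f) = w (φ (single δ 1)) * w (φ (single (-δ) (1 : k) * f)) := by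
        rw [← map_mul, ← map_mul, single_mul_single_neg_mul]
    _ < w (φ (single δ 1)) * 1 := by gcongr
    _ = _ := mul_one _

theorem eq_one {f : k⟦Γ⟧} (hf : f.orderTop = 0) : w (φ f) = 1 := by
  have h0 : f ≠ 0 := by rintro rfl; simp at hf
  have h1 := orderTop_add_orderTop_inv h0
  rw [hf, zero_add] at h1
  refine le_antisymm (hw.le_one f hf.ge) ?_
  have h2 := hw.le_one _ h1.ge
  rw [map_inv₀, map_inv₀] at h2
  exact (inv_le_one₀ (by simpa [zero_lt_iff] using h0)).1 h2

theorem eq_single {f : k⟦Γ⟧} (hf : f ≠ 0) : w (φ f) = w (φ (single f.order 1)) := by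
  have h1 : (single (-f.order) (1 : k) * f).orderTop = 0 := by
    rw [orderTop_single_mul, ← order_eq_orderTop_of_ne_zero hf]
    norm_cast
    simp
  conv_lhs => rw [← single_mul_single_neg_mul f.order f, map_mul, map_mul, hw.eq_one h1, mul_one]

theorem single_le {γ δ : Γ} (h : γ ≤ δ) : w (φ (single δ 1)) ≤ w (φ (single γ 1)) := by
  rcases h.eq_or_lt with rfl | h
  · rfl
  · refine (hw.lt_single ?_).le
    rw [orderTop_single one_ne_zero]
    exact_mod_cast h

theorem lt_orderTop {f : k⟦Γ⟧} {δ : Γ} (hf : w (φ f) < w (φ (single δ 1))) :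
    (δ : WithTop Γ) < f.orderTop := by
  by_contra h
  by_cases h0 : f = 0
  · simp [h0] at h
  rw [← order_eq_orderTop_of_ne_zero h0] at h
  norm_cast at h
  rw [hw.eq_single h0] at hf
  exact (hw.single_le (not_lt.1 h)).not_gt hf

/-- The residue field does not grow: scale `q` so that its least coefficient order is 0, keep the
constant terms, and factor the resulting nonzero polynomial over `k`. -/
theorem exists_lt_one [IsAlgClosed k] {q : Polynomial k⟦Γ⟧} {u : M} (hq : q ≠ 0)
    (hu : w u = 1) (h : q.eval₂ φ u = 0) : ∃ c : k, w (u - φ (C c)) < 1 := by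
  obtain ⟨j, hj, hmin⟩ := q.support.exists_min_image (fun j => (q.coeff j).order)
    (Polynomial.support_nonempty.2 hq)
  rw [Polynomial.mem_support_iff] at hj
  set γ : Γ := -(q.coeff j).order with hγ
  set r : ℕ → k⟦Γ⟧ := fun i => single γ 1 * q.coeff i with hr
  have hr0 : ∀ i ∈ q.support, 0 ≤ (r i).orderTop := by
    intro i hi
    have hle := hmin i hi
    rw [Polynomial.mem_support_iff] at hi
    simp only [hr]
    rw [orderTop_single_mul, ← order_eq_orderTop_of_ne_zero hi]
    norm_cast
    simpa [hγ] using hle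
  set p : Polynomial k := ∑ i ∈ q.support, Polynomial.monomial i ((r i).coeff 0) with hp
  have hp0 : p ≠ 0 := by
    intro h0
    have h1 : p.coeff j = (r j).coeff 0 := by
      simp only [hp, Polynomial.finsetSum_coeff, Polynomial.coeff_monomial]
      rw [Finset.sum_eq_single j] <;> simp +contextual [hr]
    rw [h0, Polynomial.coeff_zero] at h1
    simp only [hr, coeff_single_mul, hγ] at h1
    rw [sub_neg_eq_add, zero_add, one_mul] at h1
    exact hj (coeff_order_eq_zero.1 h1.symm)
  have hsum : ∑ i ∈ q.support, φ (r i) * u ^ i = 0 := by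
    simp only [hr, map_mul, mul_assoc]
    rw [← Finset.mul_sum]
    rw [Polynomial.eval₂_eq_sum, Polynomial.sum_def] at h
    rw [h, mul_zero]
  -- The scaled equation vanishes at `u`, so passing to constant terms leaves only errors of
  -- positive order.
  have hpu : w (p.eval₂ (φ.comp C) u) < 1 := by
    have : p.eval₂ (φ.comp C) u = ∑ i ∈ q.support, -(φ (r i - C ((r i).coeff 0)) * u ^ i) := by
      rw [hp, Polynomial.eval₂_finsetSum, Finset.sum_neg_distrib]
      simp only [map_sub, sub_mul, Finset.sum_sub_distrib, hsum, zero_sub, neg_neg,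
        Polynomial.eval₂_monomial, RingHom.comp_apply]
    rw [this]
    refine w.map_sum_lt one_ne_zero fun i hi => ?_
    rw [Valuation.map_neg, map_mul, map_pow, hu, one_pow, mul_one]
    exact hw.lt_one _ (orderTop_sub_C_coeff_zero (hr0 i hi))
  by_contra! hcon
  refine hpu.not_ge ?_
  rw [(IsAlgClosed.splits p).eq_prod_roots, Polynomial.eval₂_mul, Polynomial.eval₂_C, map_mul]
  have hl : w ((φ.comp C) p.leadingCoeff) = 1 := by
    refine hw.eq_one ?_
    rw [C_apply, orderTop_single (by simpa using hp0)]
    rfl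
  rw [hl, one_mul]
  generalize p.roots = s
  induction s using Multiset.induction with
  | empty => simp
  | cons a s ih =>
    rw [Multiset.map_cons, Multiset.prod_cons, Polynomial.eval₂_mul, map_mul]
    exact one_le_mul (by simpa using hcon a) ih

/-- The value group does not grow: in a vanishing sum two terms share the maximal value, which
determines a positive power of `w y`, and `Γ` is divisible. -/
theorem exists_eq_single [IsAlgClosed k] (hdiv : ∀ n : ℕ, n ≠ 0 → ∀ γ : Γ, ∃ δ, n • δ = γ)
    {q : Polynomial k⟦Γ⟧} {y : M} (hq : q ≠ 0)
    (hy : y ≠ 0) (h : q.eval₂ φ y = 0) : ∃ γ : Γ, w y = w (φ (single γ 1)) := by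
  obtain ⟨j, hj, hmax⟩ := q.support.exists_max_image (fun j => w (φ (q.coeff j) * y ^ j))
    (Polynomial.support_nonempty.2 hq)
  have hne : ∀ i ∈ q.support, w (φ (q.coeff i) * y ^ i) ≠ 0 := by
    intro i hi
    simpa [hy] using hi
  have : ∃ i ∈ q.support, i ≠ j ∧ w (φ (q.coeff i) * y ^ i) = w (φ (q.coeff j) * y ^ j) := by
    by_contra! hcon
    apply hne j hj
    have hsum : ∑ i ∈ q.support, φ (q.coeff i) * y ^ i = 0 := by
      rw [← h, Polynomial.eval₂_eq_sum, Polynomial.sum_def]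
    rw [← w.map_sum_eq_of_lt (f := fun i => φ (q.coeff i) * y ^ i) hj, hsum, map_zero]
    intro i hi
    simp only [Finset.mem_sdiff, Finset.mem_singleton] at hi
    exact lt_of_le_of_ne (hmax i hi.1) (hcon i hi.1 hi.2)
  obtain ⟨i, hi, hij, heq⟩ := this
  wlog hlt : i < j generalizing i j
  · refine this i hi (fun l hl => (hmax l hl).trans heq.ge) j hj hij.symm heq.symm ?_
    omega
  rw [Polynomial.mem_support_iff] at hi hj
  obtain ⟨γ, hγ⟩ := hdiv (j - i) (by omega) ((q.coeff i).order - (q.coeff j).order)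
  refine ⟨γ, ?_⟩
  have hwy : w y ≠ 0 := by simpa using hy
  have hpow : w y ^ (j - i) = w (φ (single γ 1)) ^ (j - i) := by
    rw [map_mul, map_mul, map_pow, map_pow, hw.eq_single hi, hw.eq_single hj] at heq
    have e1 : w (φ (single (q.coeff j).order 1)) * w (φ (single γ 1)) ^ (j - i) =
        w (φ (single (q.coeff i).order 1)) := by
      rw [← map_pow, ← map_pow, single_pow, hγ, ← map_mul, ← map_mul, single_mul_single]
      simp
    have e2 : w y ^ j = w y ^ i * w y ^ (j - i) := by
      rw [← _root_.pow_add, Nat.add_sub_of_le hlt.le]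
    rw [← e1, e2] at heq
    have hs : w (φ (single (q.coeff j).order 1)) ≠ 0 := by simp
    have h3 : (w (φ (single (q.coeff j).order 1)) * w y ^ i) * w (φ (single γ 1)) ^ (j - i) =
      (w (φ (single (q.coeff j).order 1)) * w y ^ i) * w y ^ (j - i) := by
      rw [mul_assoc, mul_assoc, ← heq]; ac_rfl
    exact (mul_left_cancel₀ (mul_ne_zero hs (pow_ne_zero _ hwy)) h3).symm
  exact (pow_left_inj₀ zero_le zero_le (by omega)).1 hpow

theorem exists_lt [IsAlgClosed k] (hdiv : ∀ n : ℕ, n ≠ 0 → ∀ γ : Γ, ∃ δ, n • δ = γ)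
    {y : M} (hy : y ≠ 0) (halg : φ.IsIntegralElem y) :
    ∃ (γ : Γ) (c : k), w y = w (φ (single γ 1)) ∧ w (y - φ (single γ c)) < w y := by
  obtain ⟨q, hq, h⟩ := halg
  obtain ⟨γ, hγ⟩ := hw.exists_eq_single hdiv hq.ne_zero hy h
  have hs : φ (single γ 1) ≠ 0 := by simp
  set q' := q.comp (Polynomial.C (single γ 1) * Polynomial.X) with hq'
  have h' : q'.eval₂ φ (y / φ (single γ 1)) = 0 := by
    rw [hq', Polynomial.eval₂_comp]
    simp only [Polynomial.eval₂_mul, Polynomial.eval₂_C, Polynomial.eval₂_X]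
    rwa [mul_div_cancel₀ _ hs]
  have hq0 : q' ≠ 0 := by
    intro h0
    have := congrArg (fun p => p.comp (Polynomial.C (single γ 1)⁻¹ * Polynomial.X)) h0
    simp only [hq', Polynomial.comp_assoc, Polynomial.zero_comp] at this
    simp only [Polynomial.mul_comp, Polynomial.C_comp, Polynomial.X_comp] at this
    rw [← mul_assoc, ← Polynomial.C_mul, mul_inv_cancel₀ (by simp)] at this
    simp [hq.ne_zero] at this
  have hu : w (y / φ (single γ 1)) = 1 := by
    rw [map_div₀, hγ, div_self (by simp)]
  obtain ⟨c, hc⟩ := hw.exists_lt_one hq0 hu h'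
  refine ⟨γ, c, hγ, ?_⟩
  have e : y - φ (single γ c) = φ (single γ 1) * (y / φ (single γ 1) - φ (C c)) := by
    rw [mul_sub, mul_div_cancel₀ _ hs, ← map_mul, C_apply, single_mul_single]
    simp
  rw [e, map_mul, hγ]
  calc _ < w (φ (single γ 1)) * 1 := by
        gcongr
        simp [zero_lt_iff]
    _ = _ := mul_one _

/-- Maximal completeness: glue all approximations of `x` by series into one series `a`. A nonzero
remainder `x - φ a` would have a leading monomial, giving an approximation already absorbed in `a`.
-/
theorem mem_range [IsAlgClosed k] (hdiv : ∀ n : ℕ, n ≠ 0 → ∀ γ : Γ, ∃ δ, n • δ = γ)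
    (halg : φ.IsIntegral) (x : M) : ∃ a, φ a = x := by
  classical
  -- The exponents through which `x` can be approximated: an initial segment of `Γ`, on which the
  -- coefficient at γ does not depend on the approximation.
  let S : Set Γ := {γ | ∃ b, w (x - φ b) < w (φ (single γ 1))}
  choose! b hb using (fun γ (h : γ ∈ S) => h : ∀ γ ∈ S, ∃ b, w (x - φ b) < w (φ (single γ 1)))
  have hagree : ∀ γ δ (f g : k⟦Γ⟧), γ ≤ δ → w (x - φ f) < w (φ (single γ 1)) →
      w (x - φ g) < w (φ (single δ 1)) → f.coeff γ = g.coeff γ := by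
    intro γ δ f g h hf hg
    have h1 : w (φ (f - g)) < w (φ (single γ 1)) := by
      have : φ (f - g) = (x - φ g) - (x - φ f) := by rw [map_sub]; ring
      rw [this]
      exact w.map_sub_lt (hg.trans_le (hw.single_le h)) hf
    have := coeff_eq_zero_of_lt_orderTop (hw.lt_orderTop h1)
    rwa [coeff_sub, sub_eq_zero] at this
  have hlower : ∀ γ δ, γ ≤ δ → δ ∈ S → γ ∈ S := fun γ δ h ⟨f, hf⟩ =>
    ⟨f, hf.trans_le (hw.single_le h)⟩
  have hcoeff : ∀ γ δ, γ ≤ δ → δ ∈ S → (b γ).coeff γ = (b δ).coeff γ := fun γ δ h hδ =>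
    hagree γ δ _ _ h (hb γ (hlower γ δ h hδ)) (hb δ hδ)
  let a : k⟦Γ⟧ :=
    { coeff := fun γ => if γ ∈ S then (b γ).coeff γ else 0
      -- A descending sequence in the support stays below its first term, where the coefficients are
      -- those of the single series `b (s 0)`.
      isPWO_support' := by
        apply Set.IsWF.isPWO
        rw [Set.isWF_iff_no_descending_seq]
        intro s hs hmem
        have hS : ∀ n, s n ∈ S := fun n => by
          by_contra hn
          have := hmem n
          simp [hn] at this
        have hwf := (b (s 0)).isWF_support
        rw [Set.isWF_iff_no_descending_seq] at hwf
        refine hwf s hs fun n => ?_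
        have := hmem n
        simp only [Function.mem_support, hS n, if_true] at this
        rwa [hcoeff (s n) (s 0) (hs.antitone (Nat.zero_le n)) (hS 0)] at this }
  refine ⟨a, ?_⟩
  by_contra hne
  have hxa : x - φ a ≠ 0 := fun h => hne (sub_eq_zero.1 h).symm
  obtain ⟨δ, c, h1, h2⟩ := hw.exists_lt hdiv hxa (halg _)
  have hδ : δ ∈ S := ⟨a + single δ c, by rw [← h1, map_add, ← sub_sub]; exact h2⟩
  have h3 : w (φ (a - b δ)) < w (φ (single δ 1)) := by
    apply hw.lt_single
    by_contra h
    by_cases h0 : a - b δ = 0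
    · simp [h0] at h
    have h4 := coeff_order_eq_zero.not.2 h0
    rw [← order_eq_orderTop_of_ne_zero h0] at h
    norm_cast at h
    apply h4
    rw [coeff_sub, sub_eq_zero]
    simp only [a, hlower _ _ (not_lt.1 h) hδ, if_true]
    exact hcoeff _ _ (not_lt.1 h) hδ
  have h5 : w (x - φ a) < w (φ (single δ 1)) := by
    have : x - φ a = (x - φ (b δ)) - φ (a - b δ) := by rw [map_sub]; ring
    rw [this]
    exact w.map_sub_lt (hb δ hδ) h3
  exact h5.ne h1

end ExtendsOrder

/-- The field of Hahn series over an algebraically closed field with divisible exponent group is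
algebraically closed. -/
theorem isAlgClosed [IsAlgClosed k] (hdiv : ∀ n : ℕ, n ≠ 0 → ∀ γ : Γ, ∃ δ, n • δ = γ) :
    IsAlgClosed k⟦Γ⟧ := by
  refine IsAlgClosed.of_exists_root _ fun p _ hp => ?_
  obtain ⟨B, hB⟩ := exists_extendsOrder (algebraMap k⟦Γ⟧ (AlgebraicClosure k⟦Γ⟧))
  obtain ⟨x, hx⟩ := IsAlgClosed.exists_aeval_eq_zero (AlgebraicClosure k⟦Γ⟧) p hp.degree_pos.ne'
  obtain ⟨a, rfl⟩ := hB.mem_range hdiv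
    (algebraMap_isIntegral_iff.2 inferInstance) x
  refine ⟨a, ?_⟩
  rw [Polynomial.aeval_algebraMap_apply] at hx
  simpa using hx

end AlgClosed
end HahnSeries

/-- A multiplicative family of ring endomorphisms indexed by a group consists of automorphisms. -/
def RingAut.ofRingHom {G A : Type*} [Group G] [Semiring A] (T : G → A →+* A)
    (h1 : T 1 = RingHom.id A) (hmul : ∀ g h, T (g * h) = (T g).comp (T h)) : G →* RingAut A where
  toFun g := RingEquiv.ofRingHom (T g) (T g⁻¹)
    (by rw [← hmul, mul_inv_cancel, h1]) (by rw [← hmul, inv_mul_cancel, h1])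
  map_one' := by ext x; exact congrArg (fun f => f x) h1
  map_mul' g h := by ext x; exact congrArg (fun f => f x) (hmul g h)

@[simp]
theorem RingAut.ofRingHom_apply {G A : Type*} [Group G] [Semiring A] (T : G → A →+* A)
    (h1 : T 1 = RingHom.id A) (hmul : ∀ g h, T (g * h) = (T g).comp (T h)) (g : G) (a : A) :
    RingAut.ofRingHom T h1 hmul g a = T g a := rfl

/-! ### Coefficientwise actions, and polynomials inside Hahn series -/

section HahnSeriesMap

variable {Γ R S : Type*} [AddCommGroup Γ] [LinearOrder Γ] [IsOrderedAddMonoid Γ] [CommRing R]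
  [CommRing S]

/-- The coefficientwise extension of a ring homomorphism to Hahn series. -/
noncomputable def HahnSeries.mapRingHom (f : R →+* S) : HahnSeries Γ R →+* HahnSeries Γ S where
  toFun x := x.map f
  map_one' := by ext; simp [HahnSeries.coeff_one, apply_ite f]
  map_mul' x y := HahnSeries.map_mul (f : R →ₙ+* S)
  map_zero' := by ext; simp
  map_add' x y := by ext; simp

/-- The coefficientwise action on Hahn series. -/
noncomputable def HahnSeries.mapAut (Γ R : Type*) [AddCommGroup Γ] [LinearOrder Γ] [IsOrderedAddMonoid Γ]
    [CommRing R] : RingAut R →* RingAut (HahnSeries Γ R) :=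
  RingAut.ofRingHom (fun σ => HahnSeries.mapRingHom (σ : R →+* R)) (by ext; rfl)
    (fun σ τ => by ext; rfl)

@[simp]
theorem HahnSeries.coeff_mapAut (σ : RingAut R) (x : HahnSeries Γ R) (γ : Γ) :
    (HahnSeries.mapAut Γ R σ x).coeff γ = σ (x.coeff γ) := rfl

theorem HahnSeries.mapAut_single (σ : RingAut R) (γ : Γ) (r : R) :
    HahnSeries.mapAut Γ R σ (single γ r) = single γ (σ r) := by
  ext δ
  rw [coeff_mapAut, coeff_single, coeff_single, apply_ite σ, map_zero]

/-- The exponent in the divisible group `J →₀ ℚ` of a monomial. -/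
noncomputable def monomialExponent (J : Type*) : (J →₀ ℕ) →+ Lex (J →₀ ℚ) :=
  (toLexAddEquiv (J →₀ ℚ)).toAddMonoidHom.comp
    (Finsupp.mapRange.addMonoidHom (Nat.castAddMonoidHom ℚ))

theorem monomialExponent_injective (J : Type*) : Function.Injective (monomialExponent J) :=
  (toLexAddEquiv (J →₀ ℚ)).injective.comp
    (Finsupp.mapRange_injective _ (by simp) Nat.cast_injective)

/-- The embedding of a polynomial ring into a field of Hahn series. -/
noncomputable def MvPolynomial.toHahn (J : Type*) [LinearOrder J] (f : R →+* S) :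
    MvPolynomial J R →+* HahnSeries (Lex (J →₀ ℚ)) S :=
  MvPolynomial.eval₂Hom (HahnSeries.C.comp f)
    (fun j => HahnSeries.single (monomialExponent J (Finsupp.single j 1)) 1)

theorem MvPolynomial.toHahn_monomial (J : Type*) [LinearOrder J] (f : R →+* S) (m : J →₀ ℕ)
    (r : R) : MvPolynomial.toHahn J f (monomial m r) =
      HahnSeries.single (monomialExponent J m) (f r) := by
  rw [toHahn, coe_eval₂Hom, eval₂_monomial]
  have : (m.prod fun j e =>
      (HahnSeries.single (monomialExponent J (Finsupp.single j 1)) (1 : S)) ^ e) =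
      HahnSeries.single (monomialExponent J m) 1 := by
    induction m using Finsupp.induction_linear with
    | zero => simp
    | add m n hm hn =>
      rw [Finsupp.prod_add_index' (by simp) (fun _ _ _ => pow_add _ _ _), hm, hn,
        HahnSeries.single_mul_single, map_add, one_mul]
    | single j e =>
      rw [Finsupp.prod_single_index (by simp), HahnSeries.single_pow, one_pow, ← map_nsmul,
        Finsupp.smul_single, nsmul_one]
      rfl
  rw [this, RingHom.comp_apply, HahnSeries.C_apply, HahnSeries.single_mul_single]
  simp

theorem MvPolynomial.coeff_toHahn (J : Type*) [LinearOrder J] (f : R →+* S) (P : MvPolynomial J R)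
    (m : J →₀ ℕ) : (toHahn J f P).coeff (monomialExponent J m) = f (P.coeff m) := by
  classical
  induction P using MvPolynomial.induction_on' with
  | monomial n r =>
    rw [toHahn_monomial, coeff_monomial, HahnSeries.coeff_single, apply_ite f, map_zero]
    simp only [(monomialExponent_injective J).eq_iff, eq_comm]
  | add p q hp hq => rw [map_add, HahnSeries.coeff_add, hp, hq, coeff_add, map_add]

theorem MvPolynomial.toHahn_injective (J : Type*) [LinearOrder J] {f : R →+* S}
    (hf : Function.Injective f) : Function.Injective (toHahn J f) := by
  intro P Q h
  ext m
  apply hf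
  rw [← coeff_toHahn, ← coeff_toHahn, h]

theorem MvPolynomial.mapAut_toHahn (J : Type*) [LinearOrder J] (f : R →+* S) (σ : RingAut R)
    (τ : RingAut S) (hστ : ∀ r, τ (f r) = f (σ r)) (P : MvPolynomial J R) :
    HahnSeries.mapAut _ S τ (toHahn J f P) = toHahn J f (map (σ : R →+* R) P) := by
  induction P using MvPolynomial.induction_on' with
  | monomial n r =>
    rw [map_monomial, toHahn_monomial, toHahn_monomial, HahnSeries.mapAut_single, hστ]
    rfl
  | add p q hp hq => simp only [map_add, hp, hq]

end HahnSeriesMap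

/-! ### Extending automorphisms along purely inseparable extensions -/

section Perfect

variable (k M : Type*) [Field k] [Field M] [Algebra k M] [IsPurelyInseparable k M] [PerfectField M]

/-- The unique extension of an endomorphism of a field to its perfect closure. -/
noncomputable def perfectLift (σ : k →+* k) : M →+* M :=
  ((IsPurelyInseparable.bijective_comp_algebraMap k M M).2 ((algebraMap k M).comp σ)).choose

theorem perfectLift_comp (σ : k →+* k) :
    (perfectLift k M σ).comp (algebraMap k M) = (algebraMap k M).comp σ :=
  ((IsPurelyInseparable.bijective_comp_algebraMap k M M).2 ((algebraMap k M).comp σ)).choose_spec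

/-- Automorphisms of a field extend uniquely to its perfect closure. -/
noncomputable def perfectAut : RingAut k →* RingAut M :=
  RingAut.ofRingHom (fun σ => perfectLift k M (σ : k →+* k))
    ((IsPurelyInseparable.bijective_comp_algebraMap k M M).1 (by
      change RingHom.comp _ _ = RingHom.comp _ _
      rw [perfectLift_comp]; rfl))
    (fun σ τ => (IsPurelyInseparable.bijective_comp_algebraMap k M M).1 (by
      change RingHom.comp _ _ = RingHom.comp _ _
      rw [perfectLift_comp, RingHom.comp_assoc, perfectLift_comp, ← RingHom.comp_assoc,
        perfectLift_comp]
      rfl))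

@[simp]
theorem perfectAut_algebraMap (σ : RingAut k) (x : k) :
    perfectAut k M σ (algebraMap k M x) = algebraMap k M (σ x) :=
  congrArg (fun f => f x) (perfectLift_comp k M (σ : k →+* k))

/-- A Frobenius power of `a` lies in `k`, and Frobenius is injective. Thus stabilizers of elements
of the algebraic closure of `Ks` are stabilizers of elements of `Ks`. -/
theorem exists_forall_perfectAut_eq_iff (a : M) :
    ∃ b : k, ∀ σ : RingAut k, perfectAut k M σ a = a ↔ σ b = b := by
  obtain ⟨n, b, hb⟩ := IsPurelyInseparable.pow_mem k (ringExpChar k) a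
  refine ⟨b, fun σ => ?_⟩
  have : ExpChar M (ringExpChar k) := expChar_of_injective_algebraMap (algebraMap k M).injective _
  rw [← (iterateFrobenius_inj M (ringExpChar k) n).eq_iff, iterateFrobenius_def,
    iterateFrobenius_def, ← map_pow, ← hb, perfectAut_algebraMap,
    (algebraMap k M).injective.eq_iff]

end Perfect

/-! ### Galois descent for permutation modules -/

section Basis

variable {k H Y : Type*} [Field k] [Group H] [Fintype Y] (ρ : H →* RingAut k)
  (p : H →* Equiv.Perm Y)

/-- Galois descent for permutation modules: if the equivariant functions on a finite set with group
action separate points, then they contain a basis of all functions. -/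
theorem exists_equivariant_basis
    (hsep : ∀ y z : Y, y ≠ z → ∃ a : Y → k, (∀ h x, a (p h x) = ρ h (a x)) ∧ a y ≠ a z) :
    ∃ b : Module.Basis Y k (Y → k), ∀ j h x, b j (p h x) = ρ h (b j x) := by
  classical
  -- Multiplicative structure is what counts: evaluations at points are distinct characters of `A`,
  -- so by Dedekind independence no nonzero functional kills `A`.
  let A : Submonoid (Y → k) :=
    { carrier := {a | ∀ h x, a (p h x) = ρ h (a x)}
      mul_mem' := fun {a b} ha hb h x => by simp [ha h x, hb h x]
      one_mem' := fun h x => by simp }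
  have hA : ∀ a, a ∈ A ↔ ∀ h x, a (p h x) = ρ h (a x) := fun a => Iff.of_eq (by
    change (a ∈ {a : Y → k | ∀ h x, a (p h x) = ρ h (a x)}) = _
    simp)
  have hspan : ⊤ ≤ Submodule.span k (A : Set (Y → k)) := by
    by_contra hcon
    obtain ⟨f, hf0, hf⟩ := Submodule.exists_le_ker_of_lt_top _
      (lt_top_iff_ne_top.2 fun h => hcon h.ge)
    let ev : Y → (A →* k) := fun y => (Pi.evalMonoidHom (fun _ => k) y).comp A.subtype
    have hev : Function.Injective ev := by
      intro y z h
      by_contra hne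
      obtain ⟨a, ha, hyz⟩ := hsep y z hne
      exact hyz (congrArg (fun g => g ⟨a, (hA a).2 ha⟩) h)
    have hli := (linearIndependent_monoidHom A k).comp ev hev
    rw [Fintype.linearIndependent_iff] at hli
    have hfe : ∀ v : Y → k, f v = ∑ y, f (Pi.single y 1) * v y := by
      intro v
      conv_lhs => rw [pi_eq_sum_univ' v]
      rw [map_sum]
      refine Finset.sum_congr rfl fun y _ => ?_
      rw [map_smul, smul_eq_mul, mul_comm]
    have h0 := hli (fun y => f (Pi.single y 1)) (by
      ext a
      have : f a = 0 := hf (Submodule.subset_span a.2)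
      rw [hfe] at this
      simpa [Finset.sum_apply, ev] using this)
    apply hf0
    ext v
    simp [h0]
  let b := Module.Basis.ofSpan hspan
  refine ⟨b.reindex (b.indexEquiv (Pi.basisFun k Y)), fun j => ?_⟩
  rw [Module.Basis.reindex_apply]
  exact (hA _).1 (Module.Basis.ofSpan_subset hspan ⟨_, rfl⟩)

end Basis

/-! ### Semilinear permutation actions on rational function fields -/

section SemilinearAction

variable {G R D : Type*} {Y : D → Type*} [Group G] [CommRing R]

open MvPolynomial

/-- The action of a group on polynomials through an action on the coefficients and permutations of
the variables. -/
noncomputable def semilinearAut (π : G →* RingAut R) (p : ∀ d, G →* Equiv.Perm (Y d)) :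
    G →* RingAut (MvPolynomial (Σ d, Y d) R) :=
  RingAut.ofRingHom
    (fun g => eval₂Hom (C.comp (π g : R →+* R)) (fun x => X ⟨x.1, p x.1 g x.2⟩))
    (by ext <;> simp) (fun g h => by ext <;> simp)

@[simp]
theorem semilinearAut_C (π : G →* RingAut R) (p : ∀ d, G →* Equiv.Perm (Y d)) (g : G) (r : R) :
    semilinearAut π p g (C r) = C (π g r) := by
  simp [semilinearAut]

@[simp]
theorem semilinearAut_X (π : G →* RingAut R) (p : ∀ d, G →* Equiv.Perm (Y d)) (g : G) (d : D)
    (y : Y d) : semilinearAut π p g (X ⟨d, y⟩) = X ⟨d, p d g y⟩ := by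
  simp [semilinearAut]

/-- The action on the fraction field induced by an action on a domain. -/
noncomputable def fractionAut {A : Type*} [CommRing A] [IsDomain A] (τ : G →* RingAut A) :
    G →* RingAut (FractionRing A) :=
  RingAut.ofRingHom (fun g => IsFractionRing.map (j := (τ g : A →+* A)) (τ g).injective)
    (IsLocalization.ringHom_ext (nonZeroDivisors A) (by
      ext x
      simp only [RingHom.comp_apply, IsFractionRing.map, IsLocalization.map_eq]
      simp))
    (fun g h => IsLocalization.ringHom_ext (nonZeroDivisors A) (by
      ext x
      simp only [RingHom.comp_apply, IsFractionRing.map, IsLocalization.map_eq]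
      simp))

@[simp]
theorem fractionAut_algebraMap {A : Type*} [CommRing A] [IsDomain A] (τ : G →* RingAut A) (g : G)
    (a : A) : fractionAut τ g (algebraMap A (FractionRing A) a) =
      algebraMap A (FractionRing A) (τ g a) := by
  simp [fractionAut, IsFractionRing.map]

end SemilinearAction

/-! ### Straightening the action by a linear change of variables -/

section Straighten

open MvPolynomial

variable {k H D : Type*} {Y : D → Type*} [Field k] [Group H] [∀ d, Fintype (Y d)]
  (ρ : H →* RingAut k) (p : ∀ d, H →* Equiv.Perm (Y d))

/-- A semilinear permutation action on polynomials becomes coefficientwise after a linear change of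
variables. -/
theorem exists_straighten
    (hsep : ∀ d, ∀ y z : Y d, y ≠ z →
      ∃ a : Y d → k, (∀ h x, a (p d h x) = ρ h (a x)) ∧ a y ≠ a z) :
    ∃ φ : MvPolynomial (Σ d, Y d) k →+* MvPolynomial (Σ d, Y d) k, Function.Injective φ ∧
      ∀ h P, φ (semilinearAut ρ p h P) = map (ρ h : k →+* k) (φ P) := by
  classical
  choose b hb using fun d => exists_equivariant_basis ρ (p d) (hsep d)
  -- The new variables are indexed by basis elements and are fixed by `H`; equivariance of `b` moves
  -- the permutation of `y` into the coefficients. The map `ψ` expands indicator functions in the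
  -- basis and is a left inverse.
  let φ : MvPolynomial (Σ d, Y d) k →ₐ[k] MvPolynomial (Σ d, Y d) k :=
    aeval fun x => ∑ j, C (b x.1 j x.2) * X ⟨x.1, j⟩
  let ψ : MvPolynomial (Σ d, Y d) k →ₐ[k] MvPolynomial (Σ d, Y d) k :=
    aeval fun x => ∑ y, C ((b x.1).repr (Pi.single y 1) x.2) * X ⟨x.1, y⟩
  have hψφ : ψ.comp φ = AlgHom.id k _ := by
    ext1 ⟨d, y⟩
    simp only [AlgHom.comp_apply, φ, ψ, aeval_X, map_sum, map_mul, algHom_C, AlgHom.id_apply,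
      algebraMap_eq, Finset.mul_sum]
    change ∑ j : Y d, ∑ y' : Y d, C (b d j y) * (C ((b d).repr (Pi.single y' 1) j) *
      (X ⟨d, y'⟩ : MvPolynomial (Σ d, Y d) k)) = _
    rw [Finset.sum_comm]
    have h1 : ∀ y' : Y d, ∑ j, b d j y * (b d).repr (Pi.single y' 1) j =
        (Pi.single y' (1 : k) : Y d → k) y := by
      intro y'
      have := congrArg (fun v => v y) ((b d).sum_repr (Pi.single y' 1))
      simpa [Finset.sum_apply, mul_comm] using this
    have h2 : ∀ y' : Y d, ∑ j, C (b d j y) * (C ((b d).repr (Pi.single y' 1) j) *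
        (X ⟨d, y'⟩ : MvPolynomial (Σ d, Y d) k)) =
        C ((Pi.single y' (1 : k) : Y d → k) y) * X ⟨d, y'⟩ := by
      intro y'
      rw [← h1, map_sum, Finset.sum_mul]
      simp only [map_mul, mul_assoc]
    rw [Finset.sum_congr rfl fun y' _ => h2 y', Finset.sum_eq_single y]
    · simp
    · intro z _ hz
      simp [Pi.single_eq_of_ne hz.symm]
    · simp
  refine ⟨φ, ?_, fun h P => ?_⟩
  · intro P Q hPQ
    have := congrArg ψ (show φ P = φ Q from hPQ)
    rwa [← AlgHom.comp_apply, ← AlgHom.comp_apply, hψφ] at this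
  · have : φ.toRingHom.comp
        (semilinearAut ρ p h : MvPolynomial (Σ d, Y d) k →+* MvPolynomial (Σ d, Y d) k) =
        (map (ρ h : k →+* k)).comp φ.toRingHom := by
      ext1
      · ext1 r
        simp [algebraMap_eq]
      · rename_i x
        obtain ⟨d, y⟩ := x
        simp [φ, hb]
    exact congrArg (fun f => f P) this

end Straighten

/-! ### Restriction to normal subextensions and continuity -/

section Lift

/-- An action on a field that preserves a base field restricts to normal subextensions. -/
theorem exists_restrict_normal {k Ω L A : Type*} [Field k] [Field Ω] [Field L] [Algebra k Ω]
    [Normal k Ω] [Group A] (j : Ω →+* L) (ρ : A →* RingAut L)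
    (hρ : ∀ a c, ρ a (j (algebraMap k Ω c)) = j (algebraMap k Ω c)) :
    ∃ s : A →* Gal(Ω/k), ∀ a x, j (s a x) = ρ a (j x) := by
  let _ : Algebra Ω L := j.toAlgebra
  let _ : Algebra k L := (j.comp (algebraMap k Ω)).toAlgebra
  have : IsScalarTower k Ω L := IsScalarTower.of_algebraMap_eq fun _ => rfl
  let ρ' : A →* Gal(L/k) :=
    { toFun := fun a => AlgEquiv.ofRingEquiv (f := ρ a) (hρ a)
      map_one' := by ext x; simp
      map_mul' := fun a b => by ext x; simp }
  refine ⟨(AlgEquiv.restrictNormalHom Ω).comp ρ', fun a x => ?_⟩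
  exact AlgEquiv.restrictNormal_commutes (ρ' a) Ω x

/-- Krull neighbourhoods of 1 contain fixing subgroups of finitely generated subextensions, so
finitely many stabilizers suffice. -/
theorem continuous_gal_of_isOpen {k Ω A : Type*} [Field k] [Field Ω] [Algebra k Ω] [Group A]
    [TopologicalSpace A] [IsTopologicalGroup A] (s : A →* Gal(Ω/k))
    (hs : ∀ x, IsOpen {a | s a x = x}) : Continuous s := by
  refine continuous_of_continuousAt_one s fun U hU => ?_
  rw [map_one, krullTopology_mem_nhds_one_iff] at hU
  obtain ⟨E, hE, hEU⟩ := hU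
  obtain ⟨t, ht⟩ := IntermediateField.essFiniteType_iff.1 (inferInstance : Algebra.EssFiniteType k E)
  have hopen : IsOpen (⋂ x ∈ t, {a | s a x = x}) := isOpen_biInter_finset fun x _ => hs x
  refine Filter.mem_map.2 (Filter.mem_of_superset (hopen.mem_nhds (by simp)) fun a ha => hEU ?_)
  rw [← ht]
  simp only [Set.mem_iInter] at ha
  rw [SetLike.mem_coe, IntermediateField.mem_fixingSubgroup_iff]
  have hle : IntermediateField.adjoin k (t : Set Ω) ≤
      IntermediateField.fixedField (Subgroup.zpowers (s a)) := by
    rw [IntermediateField.adjoin_le_iff]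
    intro x hx
    have hx' : s a x = x := by simpa using ha x hx
    rw [SetLike.mem_coe, IntermediateField.mem_fixedField_iff]
    intro f hf
    have : Subgroup.zpowers (s a) ≤ MulAction.stabilizer Gal(Ω/k) x := by
      rw [Subgroup.zpowers_le]; exact hx'
    exact this hf
  intro x hx
  exact (IntermediateField.mem_fixedField_iff _ _).1 (hle hx) _ (Subgroup.mem_zpowers _)

end Lift

/-! ### Lifting the action of a closed subgroup to the separable closure -/

/-- Galois automorphisms as ring automorphisms. -/
def galRingAut (K L : Type*) [Field K] [Field L] [Algebra K L] : Gal(L/K) →* RingAut L where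
  toFun σ := σ.toRingEquiv
  map_one' := rfl
  map_mul' _ _ := rfl

/-- For `z = g y`, the Galois correspondence yields β fixed by the stabilizer of `y` but moved by
`g`; send `h y` to `h β`. For different orbits, an indicator function separates. -/
theorem exists_equivariant_ne {K Ks Y : Type*} [Field K] [Field Ks] [Algebra K Ks] [IsGalois K Ks]
    (H : Subgroup Gal(Ks/K)) (hH : IsClosed (H : Set Gal(Ks/K))) (p : H →* Equiv.Perm Y)
    (hp : ∀ y, IsOpen {h | p h y = y}) (y z : Y) (hyz : y ≠ z) :
    ∃ a : Y → Ks, (∀ (h : H) x, a (p h x) = (h : Gal(Ks/K)) (a x)) ∧ a y ≠ a z := by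
  classical
  by_cases hz : ∃ g, p g y = z
  · obtain ⟨g, rfl⟩ := hz
    let U : Subgroup H :=
      { carrier := {h | p h y = y}
        mul_mem' := fun {a b} ha hb => by
          simp only [Set.mem_ofPred_eq] at *; rw [map_mul, Equiv.Perm.mul_apply, hb, ha]
        one_mem' := by simp
        inv_mem' := fun {a} ha => by
          simp only [Set.mem_ofPred_eq] at *
          rw [map_inv, Equiv.Perm.inv_eq_iff_eq, ha] }
    have hU : ∀ h, h ∈ U ↔ p h y = y := fun h => by
      change h ∈ {h | p h y = y} ↔ _; simp
    have hUo : IsOpen (U : Set H) := hp y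
    have hUc : IsClosed (U : Set H) := U.isClosed_of_isOpen hUo
    let V : ClosedSubgroup Gal(Ks/K) :=
      { U.map H.subtype with
        isClosed' := by
          change IsClosed ((U.map H.subtype : Subgroup _) : Set Gal(Ks/K))
          rw [Subgroup.coe_map]
          exact hH.isClosedEmbedding_subtypeVal.isClosedMap _ hUc }
    have hg : (g : Gal(Ks/K)) ∉ (IntermediateField.fixedField V.1).fixingSubgroup := by
      rw [InfiniteGalois.fixingSubgroup_fixedField V]
      rintro ⟨g', hg', he⟩
      have : g' = g := Subtype.ext he
      subst this
      exact hyz ((hU _).1 hg').symm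
    rw [IntermediateField.mem_fixingSubgroup_iff] at hg
    push Not at hg
    obtain ⟨β, hβ, hne⟩ := hg
    have hfix : ∀ h h' : H, p h y = p h' y →
        (h : Gal(Ks/K)) β = (h' : Gal(Ks/K)) β := by
      intro h h' he
      have hmem : h'⁻¹ * h ∈ U := by
        rw [hU, map_mul, Equiv.Perm.mul_apply, he, ← Equiv.Perm.mul_apply, ← map_mul]
        simp
      have h1 := (IntermediateField.mem_fixedField_iff _ _).1 hβ _ ⟨_, hmem, rfl⟩
      have h2 := congrArg (h' : Gal(Ks/K)) h1
      rw [← AlgEquiv.mul_apply] at h2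
      simpa using h2
    let a : Y → Ks := fun x => if hx : ∃ h, p h y = x then (hx.choose : Gal(Ks/K)) β else 0
    have ha : ∀ h, a (p h y) = (h : Gal(Ks/K)) β := by
      intro h
      have hx : ∃ h', p h' y = p h y := ⟨h, rfl⟩
      simp only [a, dif_pos hx]
      exact hfix _ _ hx.choose_spec
    refine ⟨a, fun h x => ?_, ?_⟩
    · by_cases hx : ∃ h', p h' y = x
      · obtain ⟨h', rfl⟩ := hx
        rw [← Equiv.Perm.mul_apply, ← map_mul, ha, ha]
        rfl
      · have hx' : ¬ ∃ h', p h' y = p h x := by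
          rintro ⟨h', he⟩
          refine hx ⟨h⁻¹ * h', ?_⟩
          rw [map_mul, Equiv.Perm.mul_apply, he, ← Equiv.Perm.mul_apply, ← map_mul]
          simp
        simp only [a, dif_neg hx, dif_neg hx', map_zero]
    · have h1 := ha 1
      rw [map_one, Equiv.Perm.one_apply] at h1
      rw [ha, h1]
      exact fun h => hne h.symm
  · refine ⟨fun x => if ∃ h, p h y = x then 1 else 0, fun h x => ?_, ?_⟩
    · have : (∃ h', p h' y = p h x) ↔ ∃ h', p h' y = x := by
        constructor
        · rintro ⟨h', he⟩
          refine ⟨h⁻¹ * h', ?_⟩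
          rw [map_mul, Equiv.Perm.mul_apply, he, ← Equiv.Perm.mul_apply, ← map_mul]
          simp
        · rintro ⟨h', rfl⟩
          exact ⟨h * h', by rw [map_mul, Equiv.Perm.mul_apply]⟩
      simp only [this]
      split_ifs <;> simp
    · have : ∃ h, p h y = y := ⟨1, by simp⟩
      simp [this, hz]

open MvPolynomial in
/-- A semilinear permutation action of a closed subgroup `H` of `Gal(Ks/K)` on the rational function
field over `Ks` embeds equivariantly into an algebraically closed field with an action for which the
sets `{h | h • x = x}` are closed. -/
theorem exists_equivariant_embedding {K Ks D : Type u} {Y : D → Type} [∀ d, Fintype (Y d)]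
    [Field K] [Field Ks] [Algebra K Ks] [IsSepClosure K Ks]
    (H : Subgroup Gal(Ks/K)) (hH : IsClosed (H : Set Gal(Ks/K))) (p : ∀ d, H →* Equiv.Perm (Y d))
    (hp : ∀ d y, IsOpen {h | p d h y = y}) :
    ∃ (L : Type u) (_ : Field L) (_ : IsAlgClosed L)
      (Ψ : FractionRing (MvPolynomial (Σ d, Y d) Ks) →+* L) (τ : H →* RingAut L),
      (∀ h e, τ h (Ψ e) =
        Ψ (fractionAut (semilinearAut ((galRingAut K Ks).comp H.subtype) p) h e)) ∧
      ∀ x, IsClosed {h | τ h x = x} := by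
  classical
  have : IsGalois K Ks := IsSepClosure.isGalois
  have : IsSepClosed Ks := IsSepClosure.sep_closed K
  obtain ⟨φ, hφ, hφeq⟩ := exists_straighten ((galRingAut K Ks).comp H.subtype) p
    (fun d => exists_equivariant_ne H hH (p d) (hp d))
  -- Any linear order would do: it only serves to order the exponents lexicographically.
  let _ : LinearOrder (Σ d, Y d) := linearOrderOfSTO WellOrderingRel
  let f := algebraMap Ks (AlgebraicClosure Ks)
  let Θ := (toHahn (Σ d, Y d) f).comp φ
  have hΘ : Function.Injective Θ := (toHahn_injective _ f.injective).comp hφ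
  have halg : IsAlgClosed (HahnSeries (Lex ((Σ d, Y d) →₀ ℚ)) (AlgebraicClosure Ks)) := by
    refine HahnSeries.isAlgClosed fun n hn γ => ⟨toLex ((n : ℚ)⁻¹ • ofLex γ), ?_⟩
    change toLex (n • ((n : ℚ)⁻¹ • ofLex γ)) = γ
    rw [← Nat.cast_smul_eq_nsmul ℚ, smul_smul, mul_inv_cancel₀ (by simpa), one_smul]
    rfl
  let τ₀ : H →* RingAut (AlgebraicClosure Ks) := (perfectAut Ks (AlgebraicClosure Ks)).comp
    ((galRingAut K Ks).comp H.subtype)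
  let τ : H →* RingAut (HahnSeries (Lex ((Σ d, Y d) →₀ ℚ)) (AlgebraicClosure Ks)) :=
    (HahnSeries.mapAut _ _).comp τ₀
  refine ⟨_, _, halg, IsFractionRing.lift hΘ, τ, fun h => ?_, fun x => ?_⟩
  · have : (τ h).toRingHom.comp (IsFractionRing.lift hΘ) =
        (IsFractionRing.lift hΘ).comp
          (fractionAut (semilinearAut ((galRingAut K Ks).comp H.subtype) p) h).toRingHom := by
      refine IsLocalization.ringHom_ext (nonZeroDivisors (MvPolynomial (Σ d, Y d) Ks)) ?_
      refine RingHom.ext fun P => ?_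
      simp only [RingHom.comp_apply, RingEquiv.toRingHom_eq_coe, RingEquiv.coe_toRingHom, IsFractionRing.lift_algebraMap,
        fractionAut_algebraMap, Θ, hφeq, τ, MonoidHom.comp_apply]
      exact mapAut_toHahn _ f _ _ (perfectAut_algebraMap _ _ _) _
    exact fun e => congrArg (fun g => g e) this
  -- Each coefficient has an open stabilizer, but a series may have infinitely many coefficients, so
  -- only closedness survives the intersection.
  · have hset : {h | τ h x = x} = ⋂ γ, {h | τ₀ h (x.coeff γ) = x.coeff γ} := by
      ext h
      simp only [Set.mem_ofPred_eq, Set.mem_iInter, HahnSeries.ext_iff, _root_.funext_iff]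
      rfl
    rw [hset]
    refine isClosed_iInter fun γ => ?_
    obtain ⟨b, hb⟩ := exists_forall_perfectAut_eq_iff Ks (AlgebraicClosure Ks) (x.coeff γ)
    have : {h | τ₀ h (x.coeff γ) = x.coeff γ} =
        Subtype.val ⁻¹' (MulAction.stabilizer Gal(Ks/K) b : Set Gal(Ks/K)) := by
      ext h
      exact hb _
    rw [this]
    exact (Subgroup.isClosed_of_isOpen _ (stabilizer_isOpen_of_isIntegral b)).preimage
      continuous_subtype_val

/-- A semilinear permutation action of a closed subgroup `H` of `Gal(Ks/K)` on the rational function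
field over `Ks` extends to a continuous action on the separable closure. -/
theorem exists_lift_sepClosure {K Ks D : Type u} {Y : D → Type} [∀ d, Fintype (Y d)]
    [Field K] [Field Ks] [Algebra K Ks] [IsSepClosure K Ks]
    (H : Subgroup Gal(Ks/K)) (hH : IsClosed (H : Set Gal(Ks/K))) (p : ∀ d, H →* Equiv.Perm (Y d))
    (hp : ∀ d y, IsOpen {h | p d h y = y}) {k Ω : Type u} [Field k] [Field Ω]
    [Algebra k (FractionRing (MvPolynomial (Σ d, Y d) Ks))]
    [Algebra (FractionRing (MvPolynomial (Σ d, Y d) Ks)) Ω] [Algebra k Ω]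
    [IsScalarTower k (FractionRing (MvPolynomial (Σ d, Y d) Ks)) Ω]
    [Algebra.IsAlgebraic (FractionRing (MvPolynomial (Σ d, Y d) Ks)) Ω] [IsGalois k Ω]
    (hk : ∀ h c, fractionAut (semilinearAut ((galRingAut K Ks).comp H.subtype) p) h
      (algebraMap k _ c) = algebraMap k _ c) :
    ∃ s : H →* Gal(Ω/k), Continuous s ∧ ∀ h e, s h (algebraMap _ Ω e) =
      algebraMap _ Ω (fractionAut (semilinearAut ((galRingAut K Ks).comp H.subtype) p) h e) := by
  obtain ⟨L, _, _, Ψ, τ, hτ, hcl⟩ := exists_equivariant_embedding H hH p hp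
  let _ : Algebra (FractionRing (MvPolynomial (Σ d, Y d) Ks)) L := Ψ.toAlgebra
  let j : Ω →ₐ[FractionRing (MvPolynomial (Σ d, Y d) Ks)] L := IsAlgClosed.lift
  have hj : ∀ e, j (algebraMap _ Ω e) = Ψ e := fun e => j.commutes e
  have hjk : ∀ c, j (algebraMap k Ω c) = Ψ (algebraMap k _ c) := fun c => by
    rw [IsScalarTower.algebraMap_apply k (FractionRing (MvPolynomial (Σ d, Y d) Ks)) Ω, hj]
  obtain ⟨s, hs⟩ := exists_restrict_normal (k := k) (j : Ω →+* L) τ (fun a c => by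
    change τ a (j _) = j _
    rw [hjk, hτ, hk])
  change ∀ a x, j (s a x) = τ a (j x) at hs
  have := isCompact_iff_compactSpace.1 hH.isCompact
  refine ⟨s, continuous_gal_of_isOpen s fun x => ?_, fun h e => (j : Ω →+* L).injective ?_⟩
  -- Finite index comes from `x` being algebraic over `k`, closedness from the action on `L`;
  -- together they give openness.
  · let S := (MulAction.stabilizer Gal(Ω/k) x).comap s
    have hS : (S : Set H) = {h | s h x = x} := rfl
    have hfin : (MulAction.stabilizer Gal(Ω/k) x).FiniteIndex := by
      have := Subgroup.quotient_finite_of_isOpen _ (stabilizer_isOpen_of_isIntegral (K := k) x)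
      exact Subgroup.finiteIndex_of_finite_quotient
    rw [← hS]
    have hSfin : S.FiniteIndex := ⟨fun h0 => hfin.1
      (Subgroup.index_eq_zero_of_relIndex_eq_zero (by rwa [Subgroup.index_comap] at h0))⟩
    refine Subgroup.isOpen_of_isClosed_of_finiteIndex S ?_
    have : (S : Set H) = {h | τ h (j x) = j x} := by
      ext h
      rw [hS]
      simp only [Set.mem_ofPred_eq]
      rw [← hs]
      exact (j : Ω →+* L).injective.eq_iff.symm
    rw [this]
    exact hcl _
  · change j _ = j _
    rw [hs, hj, hτ, hj]

/-! ### Free products of profinite groups -/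

/-- The discrete topology on the symmetric group. -/
instance permFinTopologicalSpace (m : ℕ) : TopologicalSpace (Equiv.Perm (Fin m)) := ⊥

instance permFinDiscreteTopology (m : ℕ) : DiscreteTopology (Equiv.Perm (Fin m)) := ⟨rfl⟩

/-- The points of a profinite group are separated by permutation representations. -/
theorem exists_perm_ne_one {P : Type*} [Group P] [TopologicalSpace P] [IsTopologicalGroup P]
    [CompactSpace P] [TotallyDisconnectedSpace P] {x : P} (hx : x ≠ 1) :
    ∃ (m : ℕ) (χ : P →ₜ* Equiv.Perm (Fin m)), χ x ≠ 1 := by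
  obtain ⟨U, hU⟩ := ProfiniteGrp.exist_openNormalSubgroup_sub_open_nhds_of_one
    (isOpen_compl_singleton (x := x)) (by simpa using hx.symm)
  have hfin : Finite (P ⧸ (U : Subgroup P)) :=
    Subgroup.quotient_finite_of_isOpen (U : Subgroup P) U.isOpen'
  obtain ⟨m, ⟨e⟩⟩ := Finite.exists_equiv_fin (P ⧸ (U : Subgroup P))
  let χ : P →* Equiv.Perm (Fin m) :=
    (e.permCongrHom : Equiv.Perm _ →* _).comp (MulAction.toPermHom P (P ⧸ (U : Subgroup P)))
  have hχ : ∀ g, χ g = 1 → g ∈ (U : Subgroup P) := by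
    intro g hg
    have h1 : MulAction.toPermHom P (P ⧸ (U : Subgroup P)) g = 1 :=
      e.permCongrHom.injective (by rw [map_one]; exact hg)
    have h2 := congrArg (fun σ => σ ((1 : P) : P ⧸ (U : Subgroup P))) h1
    have h3 : ((g * 1 : P) : P ⧸ (U : Subgroup P)) = ((1 : P) : P ⧸ (U : Subgroup P)) := h2
    rw [mul_one, QuotientGroup.eq] at h3
    simpa using h3
  have hχ' : ∀ g ∈ (U : Subgroup P), χ g = 1 := by
    intro g hg
    have h1 : MulAction.toPermHom P (P ⧸ (U : Subgroup P)) g = 1 := by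
      ext y
      induction y using QuotientGroup.induction_on with | H y =>
      change ((g * y : P) : P ⧸ (U : Subgroup P)) = (y : P ⧸ (U : Subgroup P))
      rw [QuotientGroup.eq]
      have hn : (U : Subgroup P).Normal := U.isNormal'
      have := hn.conj_mem g⁻¹ (inv_mem hg) y⁻¹
      simpa [mul_assoc] using this
    change e.permCongrHom _ = 1
    rw [h1, map_one]
  have hcont : Continuous χ := by
    refine continuous_of_continuousAt_one χ ?_
    rw [ContinuousAt, map_one, nhds_discrete (Equiv.Perm (Fin m)), Filter.tendsto_pure]
    exact Filter.mem_of_superset (U.isOpen'.mem_nhds (one_mem (U : Subgroup P))) hχ'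
  refine ⟨m, ⟨χ, hcont⟩, fun h => ?_⟩
  exact hU (hχ x h) rfl

section Coprod

variable {ι : Type} (A : ι → Type u) [∀ i, Group (A i)] [∀ i, TopologicalSpace (A i)]

/-- Families of permutation representations of the factors on a common finite set. -/
def PermFamily : Type u := Σ m : ℕ, ∀ i, A i →ₜ* Equiv.Perm (Fin m)

/-- The diagonal map of a factor into a product of symmetric groups. -/
def permDiagonal (i : ι) : A i →ₜ* ∀ d : PermFamily A, Equiv.Perm (Fin d.1) where
  toFun g d := d.2 i g
  map_one' := by ext; simp
  map_mul' g h := by ext; simp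
  continuous_toFun := continuous_pi fun d => (d.2 i).continuous_toFun

/-- The free product of a family of topological groups in the category of profinite groups. -/
def ProfiniteCoprod : Subgroup (∀ d : PermFamily A, Equiv.Perm (Fin d.1)) :=
  (⨆ i, (permDiagonal A i).toMonoidHom.range).topologicalClosure

theorem isClosed_profiniteCoprod :
    IsClosed (ProfiniteCoprod A : Set (∀ d : PermFamily A, Equiv.Perm (Fin d.1))) :=
  Subgroup.isClosed_topologicalClosure _

instance : CompactSpace (ProfiniteCoprod A) :=
  isCompact_iff_compactSpace.1 (isClosed_profiniteCoprod A).isCompact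

namespace ProfiniteCoprod

/-- The canonical map of a factor into the profinite free product. -/
def of (i : ι) : A i →ₜ* ProfiniteCoprod A where
  toFun g := ⟨permDiagonal A i g, Subgroup.le_topologicalClosure _
    (Subgroup.mem_iSup_of_mem i ⟨g, rfl⟩)⟩
  map_one' := by ext1; simp
  map_mul' g h := by ext1; simp
  continuous_toFun := (permDiagonal A i).continuous_toFun.subtype_mk _

/-- The permutation representation of the profinite free product with index `d`. -/
def perm (d : PermFamily A) : ProfiniteCoprod A →ₜ* Equiv.Perm (Fin d.1) where
  toFun g := g.1 d
  map_one' := rfl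
  map_mul' _ _ := rfl
  continuous_toFun := (continuous_apply d).comp continuous_subtype_val

variable {A}

theorem ext_perm {g h : ProfiniteCoprod A} (H : ∀ d, perm A d g = perm A d h) : g = h :=
  Subtype.ext (funext H)

theorem eq_top_of_isClosed (S : Subgroup (ProfiniteCoprod A))
    (hS : IsClosed (S : Set (ProfiniteCoprod A))) (h : ∀ i g, of A i g ∈ S) : S = ⊤ := by
  rw [eq_top_iff]
  have hc : IsClosed ((S.map (ProfiniteCoprod A).subtype : Subgroup _) :
      Set (∀ d : PermFamily A, Equiv.Perm (Fin d.1))) := by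
    rw [Subgroup.coe_map]
    exact (isClosed_profiniteCoprod A).isClosedEmbedding_subtypeVal.isClosedMap _ hS
  have hle : ProfiniteCoprod A ≤ S.map (ProfiniteCoprod A).subtype := by
    refine Subgroup.topologicalClosure_minimal _ (iSup_le fun i => ?_) hc
    rintro _ ⟨g, rfl⟩
    exact ⟨of A i g, h i g, rfl⟩
  intro x _
  obtain ⟨y, hy, hyx⟩ := hle x.2
  have : y = x := Subtype.ext hyx
  exact this ▸ hy

theorem hom_ext {P : Type*} [Group P] [TopologicalSpace P] [T2Space P]
    {f g : ProfiniteCoprod A →ₜ* P} (h : ∀ i x, f (of A i x) = g (of A i x)) : f = g := by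
  have := eq_top_of_isClosed (f.toMonoidHom.eqLocus g.toMonoidHom)
    (isClosed_eq f.continuous_toFun g.continuous_toFun) h
  ext x
  have hx : x ∈ f.toMonoidHom.eqLocus g.toMonoidHom := this ▸ Subgroup.mem_top x
  exact hx

/-- The closed subgroup `C` generated by the pairs (`of A i g`, `η i g`) is the graph of the lift:
its projection to the free product is bijective, and compactness makes the inverse continuous. -/
theorem exists_lift {P : Type*} [Group P] [TopologicalSpace P] [IsTopologicalGroup P]
    [CompactSpace P] [TotallyDisconnectedSpace P] (η : ∀ i, A i →ₜ* P) :
    ∃ f : ProfiniteCoprod A →ₜ* P, ∀ i g, f (of A i g) = η i g := by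
  let C : Subgroup (ProfiniteCoprod A × P) :=
    (⨆ i, ((of A i).prod (η i)).toMonoidHom.range).topologicalClosure
  have hCc : IsClosed (C : Set (ProfiniteCoprod A × P)) := Subgroup.isClosed_topologicalClosure _
  have hC : ∀ i g, (of A i g, η i g) ∈ C := fun i g =>
    Subgroup.le_topologicalClosure _ (Subgroup.mem_iSup_of_mem i ⟨g, rfl⟩)
  have : CompactSpace C := isCompact_iff_compactSpace.1 hCc.isCompact
  let π : C →* ProfiniteCoprod A := (MonoidHom.fst _ _).comp C.subtype
  have hπc : Continuous π := continuous_fst.comp continuous_subtype_val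
  have hinj : Function.Injective π := by
    rw [injective_iff_map_eq_one]
    rintro ⟨⟨g, x⟩, hgx⟩ h1
    change g = 1 at h1
    subst h1
    have hx : x = 1 := by
      by_contra hx
      obtain ⟨m, χ, hχ⟩ := exists_perm_ne_one hx
      -- The composites of χ with the `η i` form one of the indices, so on `C` the first component
      -- determines χ of the second.
      let d : PermFamily A := ⟨m, fun i => χ.comp (η i)⟩
      let E := ((perm A d).toMonoidHom.comp (MonoidHom.fst _ P)).eqLocus
        (χ.toMonoidHom.comp (MonoidHom.snd _ P))
      have hE : C ≤ E := by
        refine Subgroup.topologicalClosure_minimal _ (iSup_le fun i => ?_) ?_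
        · rintro _ ⟨g, rfl⟩
          rfl
        · exact isClosed_eq ((perm A d).continuous_toFun.comp continuous_fst)
            (χ.continuous_toFun.comp continuous_snd)
      have h2 : perm A d 1 = χ x := hE hgx
      rw [map_one] at h2
      exact hχ h2.symm
    subst hx
    rfl
  have hsurj : Function.Surjective π := by
    rw [← MonoidHom.range_eq_top]
    refine eq_top_of_isClosed _ ?_ fun i g => ⟨⟨_, hC i g⟩, rfl⟩
    rw [MonoidHom.coe_range]
    exact (isCompact_range hπc).isClosed
  let e : C ≃* ProfiniteCoprod A := MulEquiv.ofBijective π ⟨hinj, hsurj⟩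
  let e' : C ≃ₜ ProfiniteCoprod A := Continuous.homeoOfEquivCompactToT2 (f := e.toEquiv) hπc
  refine ⟨⟨((MonoidHom.snd _ _).comp C.subtype).comp e.symm.toMonoidHom,
    (continuous_snd.comp continuous_subtype_val).comp e'.symm.continuous⟩, fun i g => ?_⟩
  have h1 : e.symm (of A i g) = ⟨_, hC i g⟩ := by
    rw [MulEquiv.symm_apply_eq]
    rfl
  change (e.symm (of A i g)).1.2 = η i g
  rw [h1]

end ProfiniteCoprod

end Coprod

/-! ### Cardinality bounds -/

theorem exists_finset_ker {K L Q : Type*} [Field K] [Field L] [Algebra K L] [Group Q]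
    [TopologicalSpace Q] [DiscreteTopology Q] (H : Subgroup Gal(L/K)) (χ : H →ₜ* Q) :
    ∃ t : Finset L, ∀ h : H, (∀ x ∈ t, (h : Gal(L/K)) x = x) → χ h = 1 := by
  have h1 : χ ⁻¹' {1} ∈ nhds (1 : H) := by
    refine (isOpen_discrete _).preimage χ.continuous_toFun |>.mem_nhds ?_
    simp
  rw [nhds_subtype_eq_comap, Filter.mem_comap] at h1
  obtain ⟨U, hU, hUχ⟩ := h1
  obtain ⟨E, hE, hEU⟩ := (krullTopology_mem_nhds_one_iff K L U).1 hU
  obtain ⟨t, rfl⟩ := IntermediateField.essFiniteType_iff.1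
    (inferInstance : Algebra.EssFiniteType K E)
  refine ⟨t, fun h hh => hUχ (hEU ?_)⟩
  rw [SetLike.mem_coe, IntermediateField.mem_fixingSubgroup_iff]
  exact (IntermediateField.forall_mem_adjoin_smul_eq_self_iff K (S := (t : Set L)) (h : Gal(L/K))).2
    hh

/-- Each homomorphism is trivial on the pointwise stabilizer of a finite subset of `L`; for a given
subset it factors through finitely many cosets, leaving finitely many choices. -/
theorem mk_continuousMonoidHom_le {K L : Type u} {Q : Type} [Field K] [Field L] [Algebra K L]
    [IsGalois K L] [Group Q] [Finite Q]
    [TopologicalSpace Q] [DiscreteTopology Q] (H : Subgroup Gal(L/K))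
    (hH : IsClosed (H : Set Gal(L/K))) : #(H →ₜ* Q) ≤ max ℵ₀ #K := by
  classical
  have := isCompact_iff_compactSpace.1 hH.isCompact
  choose t ht using fun χ : H →ₜ* Q => exists_finset_ker H χ
  have hfib : ∀ s : Finset L, #(t ⁻¹' {s}) ≤ ℵ₀ := by
    intro s
    let N : Subgroup H := (⨅ x ∈ s, MulAction.stabilizer Gal(L/K) x).subgroupOf H
    have hN : IsOpen (N : Set H) := by
      have : ((⨅ x ∈ s, MulAction.stabilizer Gal(L/K) x : Subgroup _) : Set Gal(L/K)) =
          ⋂ x ∈ s, (MulAction.stabilizer Gal(L/K) x : Set Gal(L/K)) := by simp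
      have h1 : IsOpen ((⨅ x ∈ s, MulAction.stabilizer Gal(L/K) x : Subgroup _) : Set Gal(L/K)) := by
        rw [this]
        exact isOpen_biInter_finset fun x _ => stabilizer_isOpen_of_isIntegral x
      exact h1.preimage continuous_subtype_val
    have hfin : Finite (H ⧸ N) := Subgroup.quotient_finite_of_isOpen N hN
    have hNs : ∀ h ∈ N, ∀ x ∈ s, (h : Gal(L/K)) x = x := by
      intro h hh x hx
      have h1 : (h : Gal(L/K)) ∈ ⨅ x ∈ s, MulAction.stabilizer Gal(L/K) x := hh
      simp only [Subgroup.mem_iInf] at h1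
      exact h1 x hx
    have hinj : Function.Injective
        (fun (χ : t ⁻¹' {s}) (q : H ⧸ N) => χ.1 q.out) := by
      intro χ χ' h
      have key : ∀ (ψ : t ⁻¹' {s}) (g : H), ψ.1 g = ψ.1 (g : H ⧸ N).out := by
        intro ψ g
        have hs : t ψ.1 = s := ψ.2
        have h1 := ht ψ.1 ((g : H ⧸ N).out⁻¹ * g) (by
          rw [hs]
          refine hNs _ ?_
          rw [← QuotientGroup.eq]
          exact Quotient.out_eq _)
        rw [map_mul, map_inv, inv_mul_eq_one] at h1
        exact h1.symm
      apply Subtype.ext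
      ext g
      rw [key χ, key χ']
      exact congrFun h _
    have := Finite.of_injective _ hinj
    exact Cardinal.mk_le_aleph0
  have hL : #L ≤ max ℵ₀ #K := by
    rw [max_comm]
    exact Algebra.IsAlgebraic.cardinalMk_le_max K L
  calc #(H →ₜ* Q) ≤ #(Finset L) * ℵ₀ := Cardinal.mk_le_mk_mul_of_mk_preimage_le t hfib
    _ ≤ max ℵ₀ #K := by
      refine Cardinal.mul_le_of_le (le_max_left _ _) ?_ (le_max_left _ _)
      rcases finite_or_infinite L with h | h
      · exact (Cardinal.mk_le_aleph0).trans (le_max_left _ _)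
      · rwa [Cardinal.mk_finset_of_infinite]

theorem mk_permFamily_le {n : ℕ} (A : Fin n → Type u) [∀ i, Group (A i)]
    [∀ i, TopologicalSpace (A i)] {κ : Cardinal.{u}} (hκ : ℵ₀ ≤ κ)
    (h : ∀ i m, #(A i →ₜ* Equiv.Perm (Fin m)) ≤ κ) : #(PermFamily A) ≤ κ := by
  have h1 : ∀ m, #(∀ i, A i →ₜ* Equiv.Perm (Fin m)) ≤ κ := by
    intro m
    rw [Cardinal.mk_pi]
    refine (Cardinal.prod_le_prod _ (fun _ => κ) fun i => h i m).trans ?_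
    rw [Cardinal.prod_const]
    simpa using Cardinal.power_nat_le hκ
  change #(Σ m : ℕ, ∀ i, A i →ₜ* Equiv.Perm (Fin m)) ≤ κ
  rw [Cardinal.mk_sigma]
  refine (Cardinal.sum_le_sum _ (fun _ => κ) h1).trans ?_
  rw [Cardinal.sum_const]
  simpa using Cardinal.mul_le_of_le hκ hκ le_rfl

theorem mk_fractionRing_mvPolynomial_le {X k : Type u} [Field k] {κ : Cardinal.{u}} (hκ : ℵ₀ ≤ κ)
    (hX : #X ≤ κ) (hk : #k ≤ κ) : #(FractionRing (MvPolynomial X k)) ≤ κ := by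
  have h1 : #(MvPolynomial X k) ≤ κ :=
    MvPolynomial.cardinalMk_le_max.trans (max_le (max_le hk hX) hκ)
  have h2 : Function.Surjective (fun p : MvPolynomial X k × MvPolynomial X k =>
      algebraMap _ (FractionRing (MvPolynomial X k)) p.1 / algebraMap _ _ p.2) := by
    intro z
    obtain ⟨a, b, _, h⟩ := IsFractionRing.div_surjective (A := MvPolynomial X k) z
    exact ⟨(a, b), h⟩
  refine (Cardinal.mk_le_of_surjective h2).trans ?_
  rw [Cardinal.mk_prod]
  simpa using Cardinal.mul_le_of_le hκ h1 h1

/-! ### Profinite groups acting on fields, and their fixed fields -/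

section FixedSubfield

variable {G E : Type*} [Group G] [Field E] (τ : G →* RingAut E)

/-- The subfield of elements fixed by a group of automorphisms. -/
def fixedSubfield : Subfield E where
  carrier := {e | ∀ g, τ g e = e}
  mul_mem' {a b} ha hb := by
    simp only [Set.mem_ofPred_eq] at *; intro g; rw [map_mul, ha, hb]
  one_mem' := by simp
  add_mem' {a b} ha hb := by
    simp only [Set.mem_ofPred_eq] at *; intro g; rw [map_add, ha, hb]
  zero_mem' := by simp
  neg_mem' {a} ha := by
    simp only [Set.mem_ofPred_eq] at *; intro g; rw [map_neg, ha]
  inv_mem' a ha := by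
    simp only [Set.mem_ofPred_eq] at *; intro g; rw [map_inv₀, ha]

theorem mem_fixedSubfield {e : E} : e ∈ fixedSubfield τ ↔ ∀ g, τ g e = e := by
  change e ∈ {e | ∀ g, τ g e = e} ↔ _
  simp

-- The product of `X - a` over the finite orbit of `e` is separable and has invariant coefficients.
open Polynomial in
theorem isSeparable_fixedSubfield (hfin : ∀ e, (Set.range fun g => τ g e).Finite) :
    Algebra.IsSeparable (fixedSubfield τ) E := by
  classical
  refine ⟨fun e => ?_⟩
  set s := (hfin e).toFinset with hs
  have hmem : ∀ a, a ∈ s ↔ ∃ g, τ g e = a := fun a => by simp [hs]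
  set P : E[X] := ∏ a ∈ s, (X - C a) with hP
  have hPmap : ∀ g, P.map (τ g : E →+* E) = P := by
    intro g
    rw [hP, Polynomial.map_prod]
    simp only [Polynomial.map_sub, map_X, map_C]
    refine Finset.prod_bij (fun a _ => τ g a) ?_ ?_ ?_ ?_
    · intro a ha
      obtain ⟨h, rfl⟩ := (hmem a).1 ha
      exact (hmem _).2 ⟨g * h, by rw [map_mul]; rfl⟩
    · intro a _ b _ h
      exact (τ g).injective h
    · intro b hb
      obtain ⟨h, rfl⟩ := (hmem b).1 hb
      refine ⟨τ (g⁻¹ * h) e, (hmem _).2 ⟨_, rfl⟩, ?_⟩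
      change (τ g * τ (g⁻¹ * h)) e = _
      rw [← map_mul, mul_inv_cancel_left]
    · intro a _
      rfl
  have hlift : P ∈ Polynomial.lifts (algebraMap (fixedSubfield τ) E) := by
    rw [Polynomial.lifts_iff_coeff_lifts]
    intro n
    refine ⟨⟨P.coeff n, (mem_fixedSubfield τ).2 fun g => ?_⟩, rfl⟩
    conv_rhs => rw [← hPmap g, coeff_map]
    rfl
  obtain ⟨Q, hQ⟩ := (Polynomial.mem_lifts P).1 hlift
  have hsep : P.Separable := Polynomial.separable_prod_X_sub_C_iff'.2 fun _ _ _ _ h => h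
  have hQe : Polynomial.aeval e Q = 0 := by
    rw [Polynomial.aeval_def, ← Polynomial.eval_map, hQ, hP, Polynomial.eval_prod]
    exact Finset.prod_eq_zero ((hmem e).2 ⟨1, by simp⟩) (by simp)
  rw [← hQ, Polynomial.separable_map] at hsep
  exact hsep.of_dvd (minpoly.dvd _ _ hQe)

/-- The stabilizer of an element. -/
def autStabilizer (e : E) : Subgroup G where
  carrier := {g | τ g e = e}
  mul_mem' {a b} ha hb := by
    simp only [Set.mem_ofPred_eq] at *
    rw [map_mul, RingAut.mul_apply, hb, ha]
  one_mem' := by simp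
  inv_mem' {a} ha := by
    simp only [Set.mem_ofPred_eq] at *
    rw [map_inv]
    exact (RingEquiv.symm_apply_eq _).2 ha.symm

theorem mem_autStabilizer {e : E} {g : G} : g ∈ autStabilizer τ e ↔ τ g e = e := by
  change g ∈ {g | τ g e = e} ↔ _
  simp

/-- A group acting on a field maps to the Galois group over the fixed field. -/
def toGalFixedSubfield : G →* Gal(E/fixedSubfield τ) where
  toFun g := AlgEquiv.ofRingEquiv (f := τ g) fun c => (mem_fixedSubfield τ).1 c.2 g
  map_one' := by ext; simp
  map_mul' g h := AlgEquiv.ext fun x => by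
    change τ (g * h) x = τ g (τ h x)
    rw [map_mul]
    rfl

theorem toGalFixedSubfield_apply (g : G) (x : E) : toGalFixedSubfield τ g x = τ g x := rfl

variable [TopologicalSpace G] [IsTopologicalGroup G]

theorem isOpen_autStabilizer {e : E} (h : ∀ᶠ g in 𝓝 1, τ g e = e) :
    IsOpen (autStabilizer τ e : Set G) := by
  refine Subgroup.isOpen_of_mem_nhds (g := 1) _ ?_
  exact h

theorem finite_range_of_eventually [CompactSpace G] {e : E} (h : ∀ᶠ g in 𝓝 1, τ g e = e) :
    (Set.range fun g => τ g e).Finite := by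
  have := Subgroup.quotient_finite_of_isOpen _ (isOpen_autStabilizer τ h)
  refine (Set.finite_range fun q : G ⧸ autStabilizer τ e => τ q.out e).subset ?_
  rintro _ ⟨g, rfl⟩
  refine ⟨(g : G ⧸ autStabilizer τ e), ?_⟩
  have h1 : (g : G ⧸ autStabilizer τ e).out⁻¹ * g ∈ autStabilizer τ e :=
    QuotientGroup.eq.1 (Quotient.out_eq _)
  rw [mem_autStabilizer] at h1
  change τ (g : G ⧸ autStabilizer τ e).out e = τ g e
  conv_rhs => rw [← mul_inv_cancel_left (g : G ⧸ autStabilizer τ e).out g, map_mul,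
    RingAut.mul_apply, h1]

theorem isSepClosure_fixedSubfield [CompactSpace G] [IsSepClosed E]
    (h : ∀ e, ∀ᶠ g in 𝓝 1, τ g e = e) : IsSepClosure (fixedSubfield τ) E :=
  ⟨inferInstance, isSeparable_fixedSubfield τ fun e => finite_range_of_eventually τ (h e)⟩

theorem continuous_toGalFixedSubfield (h : ∀ e, ∀ᶠ g in 𝓝 1, τ g e = e) :
    Continuous (toGalFixedSubfield τ) :=
  continuous_gal_of_isOpen _ fun x => isOpen_autStabilizer τ (h x)

/-- A profinite group acting faithfully and continuously on a separably closed field is the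
absolute Galois group of its fixed field. -/
theorem bijective_toGalFixedSubfield [CompactSpace G] [IsSepClosed E]
    (h : ∀ e, ∀ᶠ g in 𝓝 1, τ g e = e) (hinj : Function.Injective τ) :
    Function.Bijective (toGalFixedSubfield τ) := by
  have := isSepClosure_fixedSubfield τ h
  have : IsGalois (fixedSubfield τ) E := IsSepClosure.isGalois
  constructor
  · intro a b hab
    refine hinj (RingEquiv.ext fun x => ?_)
    exact DFunLike.congr_fun hab x
  -- The image is compact, hence closed, and its fixed field is the base field, so the Galois
  -- correspondence makes it everything.
  · let V : ClosedSubgroup Gal(E/fixedSubfield τ) :=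
      { (toGalFixedSubfield τ).range with
        isClosed' := by
          change IsClosed ((toGalFixedSubfield τ).range : Set Gal(E/fixedSubfield τ))
          rw [MonoidHom.coe_range]
          exact (isCompact_range (continuous_toGalFixedSubfield τ h)).isClosed }
    have hV := InfiniteGalois.fixingSubgroup_fixedField V
    have hbot : IntermediateField.fixedField V.1 = ⊥ := by
      rw [eq_bot_iff]
      intro x hx
      rw [IntermediateField.mem_bot]
      refine ⟨⟨x, (mem_fixedSubfield τ).2 fun g => ?_⟩, rfl⟩
      exact (IntermediateField.mem_fixedField_iff _ _).1 hx _ ⟨g, rfl⟩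
    rw [hbot, IntermediateField.fixingSubgroup_bot] at hV
    rw [← MonoidHom.range_eq_top]
    exact hV.symm

end FixedSubfield

/-! ### Openness of stabilizers and locally constant maps -/

section Eventually

open MvPolynomial

variable {G k D : Type*} {Y : D → Type*} [Group G] [TopologicalSpace G] [Field k]

theorem eventually_fractionAut_semilinearAut (π : G →* RingAut k) (p : ∀ d, G →* Equiv.Perm (Y d))
    (hπ : ∀ c, ∀ᶠ g in 𝓝 1, π g c = c) (hp : ∀ d y, ∀ᶠ g in 𝓝 1, p d g y = y)
    (e : FractionRing (MvPolynomial (Σ d, Y d) k)) :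
    ∀ᶠ g in 𝓝 1, fractionAut (semilinearAut π p) g e = e := by
  have h1 : ∀ P : MvPolynomial (Σ d, Y d) k, ∀ᶠ g in 𝓝 1, semilinearAut π p g P = P := by
    intro P
    induction P using MvPolynomial.induction_on with
    | C c =>
      filter_upwards [hπ c] with g hg
      rw [semilinearAut_C, hg]
    | add P Q hP hQ =>
      filter_upwards [hP, hQ] with g hg hg'
      rw [map_add, hg, hg']
    | mul_X P x hP =>
      obtain ⟨d, y⟩ := x
      filter_upwards [hP, hp d y] with g hg hg'
      rw [map_mul, hg, semilinearAut_X, hg']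
  obtain ⟨a, b, _, rfl⟩ := IsFractionRing.div_surjective (A := MvPolynomial (Σ d, Y d) k) e
  filter_upwards [h1 a, h1 b] with g ha hb
  rw [map_div₀, fractionAut_algebraMap, fractionAut_algebraMap, ha, hb]

theorem isClosed_setOf_eq_of_eventually [IsTopologicalGroup G] {Z : Type*} (a b : G → Z)
    (ha : ∀ g, ∀ᶠ v in 𝓝 1, a (g * v) = a g) (hb : ∀ g, ∀ᶠ v in 𝓝 1, b (g * v) = b g) :
    IsClosed {g | a g = b g} := by
  rw [← isOpen_compl_iff, isOpen_iff_mem_nhds]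
  intro g hg
  have ht : Filter.Tendsto (fun x => g⁻¹ * x) (𝓝 g) (𝓝 1) := by
    have := (continuous_const_mul g⁻¹).tendsto g
    rwa [inv_mul_cancel] at this
  filter_upwards [ht.eventually (ha g), ht.eventually (hb g)] with x hx hx'
  rw [mul_inv_cancel_left] at hx hx'
  simp only [Set.mem_compl_iff, Set.mem_ofPred_eq] at hg ⊢
  rwa [hx, hx']

end Eventually

/-! ### The action of the free product on a separably closed field -/

section Main

open MvPolynomial

theorem mk_le_of_isAlgebraic {E L : Type u} [Field E] [Field L] [Algebra E L]
    [Algebra.IsAlgebraic E L] {κ : Cardinal.{u}} (hκ : ℵ₀ ≤ κ) (hE : #E ≤ κ) : #L ≤ κ :=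
  (Algebra.IsAlgebraic.cardinalMk_le_max E L).trans (max_le hE hκ)

/-- The absolute Galois groups of intermediate fields. -/
abbrev absGal {K Ks : Type u} [Field K] [Field Ks] [Algebra K Ks] {n : ℕ}
    (Ki : Fin n → IntermediateField K Ks) (i : Fin n) : Type u :=
  (Ki i).fixingSubgroup

set_option maxHeartbeats 2000000 in
theorem exists_action {K Ks : Type u} [Field K] [Field Ks] [Algebra K Ks] [IsSepClosure K Ks]
    {n : ℕ} (Ki : Fin n → IntermediateField K Ks) :
    ∃ (Ω : Type u) (_ : Field Ω) (_ : IsSepClosed Ω) (κ : Ks →+* Ω)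
      (π : ProfiniteCoprod (absGal Ki) →ₜ* Gal(Ks/K))
      (θ : ProfiniteCoprod (absGal Ki) →* RingAut Ω),
      (∀ i g, π (ProfiniteCoprod.of (absGal Ki) i g) = g) ∧
      Function.Injective θ ∧ (∀ x, ∀ᶠ g in 𝓝 1, θ g x = x) ∧
      (∀ g c, θ g (κ c) = κ (π g c)) ∧ #Ω ≤ max ℵ₀ #K ∧
      ∃ t : Ω, (∀ g, θ g t = t) ∧ Function.Injective fun m : ℕ => t ^ m := by
  classical
  have : IsGalois K Ks := IsSepClosure.isGalois
  have hcl : ∀ i, IsClosed ((Ki i).fixingSubgroup : Set Gal(Ks/K)) := fun i =>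
    InfiniteGalois.fixingSubgroup_isClosed (Ki i)
  obtain ⟨π, hπ⟩ := ProfiniteCoprod.exists_lift (A := absGal Ki) (P := Gal(Ks/K))
    (fun i => ⟨(Ki i).fixingSubgroup.subtype, continuous_subtype_val⟩)
  replace hπ : ∀ i g, π (ProfiniteCoprod.of (absGal Ki) i g) = g := hπ
  let Y : PermFamily (absGal Ki) → Type := fun d => Fin d.1
  let p : ∀ d, ProfiniteCoprod (absGal Ki) →* Equiv.Perm (Y d) := fun d =>
    (ProfiniteCoprod.perm (absGal Ki) d).toMonoidHom
  let ρ := (galRingAut K Ks).comp π.toMonoidHom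
  let τ := fractionAut (semilinearAut ρ p)
  have hτ : ∀ e, ∀ᶠ g in 𝓝 1, τ g e = e := by
    refine eventually_fractionAut_semilinearAut ρ p (fun c => ?_) (fun d y => ?_)
    · have h1 : ∀ᶠ σ : Gal(Ks/K) in 𝓝 1, σ c = c :=
        (stabilizer_isOpen_of_isIntegral c).mem_nhds (one_mem (MulAction.stabilizer Gal(Ks/K) c))
      have h2 := π.continuous_toFun.tendsto 1
      change Filter.Tendsto π _ (𝓝 (π 1)) at h2
      rw [map_one] at h2
      exact h2.eventually h1
    · have h2 := (ProfiniteCoprod.perm (absGal Ki) d).continuous_toFun.tendsto 1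
      change Filter.Tendsto (ProfiniteCoprod.perm (absGal Ki) d) _ (𝓝 (ProfiniteCoprod.perm _ d 1))
        at h2
      rw [map_one, nhds_discrete (Equiv.Perm (Fin d.1)), Filter.tendsto_pure] at h2
      filter_upwards [h2] with g hg
      change ProfiniteCoprod.perm (absGal Ki) d g y = y
      rw [hg, Equiv.Perm.one_apply]
  have hsep : Algebra.IsSeparable (fixedSubfield τ) (FractionRing (MvPolynomial (Σ d, Y d) Ks)) :=
    isSeparable_fixedSubfield τ fun e => finite_range_of_eventually τ (hτ e)
  let Ω := SeparableClosure (FractionRing (MvPolynomial (Σ d, Y d) Ks))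
  have hsepΩ : Algebra.IsSeparable (fixedSubfield τ) Ω :=
    Algebra.IsSeparable.trans (fixedSubfield τ) (FractionRing (MvPolynomial (Σ d, Y d) Ks)) Ω
  have hΩ : IsSepClosure (fixedSubfield τ) Ω := ⟨inferInstance, hsepΩ⟩
  have hgal : IsGalois (fixedSubfield τ) Ω := IsSepClosure.isGalois
  -- On the `i`-th factor π is an inclusion, so the coefficients are acted on faithfully; this is
  -- why descent, and hence the lifting result, applies there and not directly to the whole free
  -- product.
  have hlift : ∀ i, ∃ s : absGal Ki i →ₜ* Gal(Ω/fixedSubfield τ), ∀ h e,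
      s h (algebraMap _ Ω e) = algebraMap _ Ω (τ (ProfiniteCoprod.of (absGal Ki) i h) e) := by
    intro i
    have e1 : (galRingAut K Ks).comp (Ki i).fixingSubgroup.subtype =
        ρ.comp (ProfiniteCoprod.of (absGal Ki) i).toMonoidHom := by
      refine MonoidHom.ext fun h => congrArg (galRingAut K Ks) ?_
      exact (hπ i h).symm
    have hcompat : ∀ h e, fractionAut (semilinearAut
        ((galRingAut K Ks).comp (Ki i).fixingSubgroup.subtype)
        (fun d : PermFamily (absGal Ki) => (d.2 i).toMonoidHom)) h e =
        τ (ProfiniteCoprod.of (absGal Ki) i h) e := by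
      rw [e1]
      intro h e
      rfl
    have hopen : ∀ (d : PermFamily (absGal Ki)) (y : Y d),
        IsOpen {h | (d.2 i).toMonoidHom h y = y} := by
      intro d y
      exact (isOpen_discrete {σ : Equiv.Perm (Fin d.1) | σ y = y}).preimage
        (d.2 i).continuous_toFun
    have hfix : ∀ h c, fractionAut (semilinearAut
        ((galRingAut K Ks).comp (Ki i).fixingSubgroup.subtype)
        (fun d : PermFamily (absGal Ki) => (d.2 i).toMonoidHom)) h
          (algebraMap (fixedSubfield τ) _ c) = algebraMap (fixedSubfield τ) _ c := by
      intro h c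
      rw [hcompat]
      exact (mem_fixedSubfield τ).1 c.2 _
    obtain ⟨s, hs, hse⟩ := exists_lift_sepClosure (Y := Y) (Ki i).fixingSubgroup (hcl i)
      (fun d => (d.2 i).toMonoidHom) hopen (k := fixedSubfield τ) (Ω := Ω) hfix
    refine ⟨⟨s, hs⟩, fun h e => ?_⟩
    rw [← hcompat]
    exact hse h e
  choose s₀ hs₀ using hlift
  obtain ⟨s, hs⟩ := ProfiniteCoprod.exists_lift s₀
  let θ : ProfiniteCoprod (absGal Ki) →* RingAut Ω := (galRingAut _ Ω).comp s.toMonoidHom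
  have hθ : ∀ x, ∀ᶠ g in 𝓝 1, θ g x = x := by
    intro x
    have h1 : ∀ᶠ σ : Gal(Ω/fixedSubfield τ) in 𝓝 1, σ x = x :=
      (stabilizer_isOpen_of_isIntegral x).mem_nhds (one_mem (MulAction.stabilizer _ x))
    have h2 := s.continuous_toFun.tendsto 1
    change Filter.Tendsto s _ (𝓝 (s 1)) at h2
    rw [map_one] at h2
    exact h2.eventually h1
  -- Agreement is known on the factors and is a closed condition, both sides being locally constant
  -- in `g`.
  have hθτ : ∀ g e, θ g (algebraMap _ Ω e) = algebraMap _ Ω (τ g e) := by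
    let T : Subgroup (ProfiniteCoprod (absGal Ki)) :=
      { carrier := ⋂ e, {g | θ g (algebraMap _ Ω e) = algebraMap _ Ω (τ g e)}
        mul_mem' := fun {a b} ha hb => by
          simp only [Set.mem_iInter, Set.mem_ofPred_eq] at *
          intro e
          rw [map_mul, map_mul, RingAut.mul_apply, RingAut.mul_apply, hb, ha]
        one_mem' := by simp
        inv_mem' := fun {a} ha => by
          simp only [Set.mem_iInter, Set.mem_ofPred_eq] at *
          intro e
          rw [map_inv, map_inv]
          refine (RingEquiv.symm_apply_eq _).2 ?_
          rw [ha]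
          exact congrArg _ ((RingEquiv.apply_symm_apply (τ a) e).symm) }
    have hT : T = ⊤ := by
      refine ProfiniteCoprod.eq_top_of_isClosed T ?_ fun i g => ?_
      · change IsClosed (⋂ e, {g | θ g (algebraMap _ Ω e) = algebraMap _ Ω (τ g e)})
        refine isClosed_iInter fun e => isClosed_setOf_eq_of_eventually _ _ (fun g => ?_)
          (fun g => ?_)
        · filter_upwards [hθ (algebraMap _ Ω e)] with v hv
          rw [map_mul, RingAut.mul_apply, hv]
        · filter_upwards [hτ e] with v hv
          rw [map_mul, RingAut.mul_apply, hv]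
      · change _ ∈ (⋂ e, {g | θ g (algebraMap _ Ω e) = algebraMap _ Ω (τ g e)})
        simp only [Set.mem_iInter, Set.mem_ofPred_eq]
        intro e
        rw [← hs₀, ← hs]
        rfl
    intro g
    have : g ∈ (⋂ e, {g | θ g (algebraMap _ Ω e) = algebraMap _ Ω (τ g e)}) := by
      change g ∈ T
      simp [hT]
    simpa using this
  let κ₀ : MvPolynomial (Σ d, Y d) Ks →+* Ω :=
    (algebraMap (FractionRing (MvPolynomial (Σ d, Y d) Ks)) Ω).comp (algebraMap _ _)
  have hκ₀ : Function.Injective κ₀ :=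
    (algebraMap (FractionRing (MvPolynomial (Σ d, Y d) Ks)) Ω).injective.comp
      (IsFractionRing.injective _ _)
  have hθκ : ∀ g P, θ g (κ₀ P) = κ₀ (semilinearAut ρ p g P) := by
    intro g P
    simp only [κ₀, RingHom.comp_apply]
    rw [hθτ, fractionAut_algebraMap]
  -- The trivial representation on one point contributes an invariant variable, which keeps the
  -- fixed field infinite even when `K` is finite.
  let d₀ : PermFamily (absGal Ki) := ⟨1, fun _ => 1⟩
  let x₀ : Σ d, Y d := ⟨d₀, (0 : Fin 1)⟩
  refine ⟨Ω, inferInstance, inferInstance, κ₀.comp C, π, θ, hπ, ?_, hθ, fun g c => ?_, ?_,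
    κ₀ (X x₀), fun g => ?_, ?_⟩
  · rw [injective_iff_map_eq_one]
    intro g hg
    -- Faithfulness is already visible on the variables: they record every coordinate of `g`.
    refine ProfiniteCoprod.ext_perm fun d => Equiv.ext fun y => ?_
    have h1 := hθκ g (X ⟨d, y⟩)
    rw [hg, semilinearAut_X, RingAut.one_apply] at h1
    have h2 := MvPolynomial.X_injective (hκ₀ h1)
    simp only [Sigma.mk.injEq, heq_eq_eq, true_and] at h2
    rw [map_one, Equiv.Perm.one_apply]
    exact h2.symm
  · rw [RingHom.comp_apply, hθκ, semilinearAut_C]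
    rfl
  · have hκ : ℵ₀ ≤ max ℵ₀ #K := le_max_left _ _
    have hD : #(PermFamily (absGal Ki)) ≤ max ℵ₀ #K :=
      mk_permFamily_le _ hκ fun i m => mk_continuousMonoidHom_le _ (hcl i)
    have hX : #(Σ d, Y d) ≤ max ℵ₀ #K := by
      have hinj : Function.Injective fun x : Σ d, Y d => (x.1, ULift.up.{u} (x.2 : ℕ)) := by
        rintro ⟨d, y⟩ ⟨d', y'⟩ h
        simp only [Prod.mk.injEq, ULift.up_inj] at h
        obtain ⟨rfl, h⟩ := h
        rw [Fin.ext h]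
      refine (Cardinal.mk_le_of_injective hinj).trans ?_
      rw [Cardinal.mk_prod]
      simpa using Cardinal.mul_le_of_le hκ hD hκ
    have hKs : #Ks ≤ max ℵ₀ #K := mk_le_of_isAlgebraic (E := K) hκ (le_max_right _ _)
    have hE := mk_fractionRing_mvPolynomial_le hκ hX hKs
    exact mk_le_of_isAlgebraic (E := FractionRing (MvPolynomial (Σ d, Y d) Ks)) hκ hE
  · rw [hθκ, semilinearAut_X]
    congr 2
    exact Sigma.ext rfl (heq_of_eq (Subsingleton.elim (α := Fin 1) _ _))
  · intro a b hab
    simp only [← map_pow] at hab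
    have h1 := hκ₀ hab
    rw [X_pow_eq_monomial, X_pow_eq_monomial, monomial_left_inj one_ne_zero] at h1
    exact Finsupp.single_injective _ h1

end Main

/-! ### From the constructed free product to the internal one -/

section FreeProduct

variable {n : ℕ} {A : Fin n → Type u} [∀ i, Group (A i)] [∀ i, TopologicalSpace (A i)]
  [∀ i, CompactSpace (A i)]

/-- A profinite group isomorphic to the profinite free product of compact groups is the internal
free product of the images of the factors. -/
theorem isProfiniteFreeProduct_of_bijective {Γ : Type u} [Group Γ] [TopologicalSpace Γ]
    [IsTopologicalGroup Γ] [CompactSpace Γ] [T2Space Γ] [TotallyDisconnectedSpace Γ]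
    (Φ : ProfiniteCoprod A →ₜ* Γ) (hΦ : Function.Bijective Φ)
    (H : Fin n → Subgroup Γ)
    (hH : ∀ i, H i = (Φ.toMonoidHom.comp (ProfiniteCoprod.of A i).toMonoidHom).range) :
    IsProfiniteFreeProduct H := by
  have hmem : ∀ i g, Φ (ProfiniteCoprod.of A i g) ∈ H i := fun i g => hH i ▸ ⟨g, rfl⟩
  have hmem' : ∀ i x, x ∈ H i → ∃ g, Φ (ProfiniteCoprod.of A i g) = x := by
    intro i x hx
    rw [hH] at hx
    exact hx
  have hclosed : ∀ i, IsClosed (H i : Set Γ) := by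
    intro i
    rw [hH, MonoidHom.coe_range]
    exact (isCompact_range
      (Φ.continuous_toFun.comp (ProfiniteCoprod.of A i).continuous_toFun)).isClosed
  have hdense : ∀ S : Subgroup Γ, IsClosed (S : Set Γ) → (∀ i, H i ≤ S) → S = ⊤ := by
    intro S hS h
    have h1 := ProfiniteCoprod.eq_top_of_isClosed (S.comap Φ.toMonoidHom)
      (hS.preimage Φ.continuous_toFun) (fun i g => h i (hmem i g))
    rw [eq_top_iff]
    intro x _
    obtain ⟨y, rfl⟩ := hΦ.2 x
    have : y ∈ S.comap Φ.toMonoidHom := h1 ▸ Subgroup.mem_top y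
    exact this
  refine ⟨hclosed, ?_, fun P η => ?_⟩
  · exact hdense _ (Subgroup.isClosed_topologicalClosure _) fun i =>
      (le_iSup H i).trans (Subgroup.le_topologicalClosure _)
  · let j : ∀ i, A i →ₜ* H i := fun i =>
      { toFun := fun g => ⟨Φ (ProfiniteCoprod.of A i g), hmem i g⟩
        map_one' := by ext1; simp
        map_mul' := fun a b => by ext1; simp
        continuous_toFun := (Φ.continuous_toFun.comp
          (ProfiniteCoprod.of A i).continuous_toFun).subtype_mk _ }
    obtain ⟨f, hf⟩ := ProfiniteCoprod.exists_lift (P := P) fun i => (η i).comp (j i)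
    let e : ProfiniteCoprod A ≃* Γ := MulEquiv.ofBijective Φ.toMonoidHom hΦ
    let e' : ProfiniteCoprod A ≃ₜ Γ :=
      Continuous.homeoOfEquivCompactToT2 (f := e.toEquiv) Φ.continuous_toFun
    refine ⟨⟨f.toMonoidHom.comp e.symm.toMonoidHom,
      f.continuous_toFun.comp e'.symm.continuous⟩, fun i g => ?_, fun f' hf' => ?_⟩
    · obtain ⟨a, ha⟩ := hmem' i g g.2
      have h1 : e.symm g = ProfiniteCoprod.of A i a := by
        rw [MulEquiv.symm_apply_eq]
        exact ha.symm
      change f (e.symm g) = _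
      rw [h1, hf]
      change η i (j i a) = _
      congr 1
      exact Subtype.ext ha
    · have h1 : f'.comp Φ = f := by
        refine ProfiniteCoprod.hom_ext fun i a => ?_
        rw [hf]
        exact hf' i ⟨_, hmem i a⟩
      ext x
      obtain ⟨y, rfl⟩ := hΦ.2 x
      change f' (Φ y) = f (e.symm (Φ y))
      have h2 : e.symm (Φ y) = y := e.symm_apply_apply y
      rw [h2, ← h1]
      rfl

end FreeProduct

/-! ### The field `F` and its extensions -/

theorem theorem3p3 {K Ks : Type u} [Field K] [Field Ks] [Algebra K Ks] [IsSepClosure K Ks]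
    {n : ℕ} (Ki : Fin n → IntermediateField K Ks) (hKi : ⨅ i, Ki i = ⊥) :
    ∃ (F Fs : Type u) (_ : Field F) (_ : Field Fs) (_ : Algebra F Fs) (_ : IsSepClosure F Fs)
      (_ : Algebra K F) (_ : Algebra K Fs) (_ : Algebra Ks Fs)
      (_ : IsScalarTower K F Fs) (_ : IsScalarTower K Ks Fs)
      (Fi : Fin n → IntermediateField F Fs),
      #F = max ℵ₀ #K ∧
      (∀ i, Algebra.IsSeparable F (Fi i)) ∧
      ⨅ i, Fi i = ⊥ ∧
      (∀ i, ∀ x ∈ Ki i, algebraMap Ks Fs x ∈ Fi i) ∧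
      (∀ i, Set.BijOn (absGalRes K Ks F Fs) (Fi i).fixingSubgroup (Ki i).fixingSubgroup) ∧
      IsProfiniteFreeProduct (fun i => (Fi i).fixingSubgroup) := by
  have hgal : IsGalois K Ks := IsSepClosure.isGalois
  have hcpt : ∀ i, CompactSpace (absGal Ki i) := fun i =>
    isCompact_iff_compactSpace.1 (InfiniteGalois.fixingSubgroup_isClosed (Ki i)).isCompact
  obtain ⟨Ω, _, _, κ, π, θ, hπ, hinj, hθ, hθκ, hcard, t, ht, htinj⟩ := exists_action Ki
  let G := ProfiniteCoprod (absGal Ki)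
  let ι := ProfiniteCoprod.of (absGal Ki)
  let F := fixedSubfield θ
  have hF : IsSepClosure F Ω := isSepClosure_fixedSubfield θ hθ
  have hFgal : IsGalois F Ω := IsSepClosure.isGalois
  let Φ : G →ₜ* Gal(Ω/F) := ⟨toGalFixedSubfield θ, continuous_toGalFixedSubfield θ hθ⟩
  have hΦ : Function.Bijective Φ := bijective_toGalFixedSubfield θ hθ hinj
  have hΦθ : ∀ g x, Φ g x = θ g x := toGalFixedSubfield_apply θ
  have hK : ∀ c : K, κ (algebraMap K Ks c) ∈ F := fun c => (mem_fixedSubfield θ).2 fun g => by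
    rw [hθκ, AlgEquiv.commutes]
  let _ : Algebra K F := ((κ.comp (algebraMap K Ks)).codRestrict F hK).toAlgebra
  let _ : Algebra Ks Ω := κ.toAlgebra
  let _ : Algebra K Ω := (κ.comp (algebraMap K Ks)).toAlgebra
  have : IsScalarTower K F Ω := IsScalarTower.of_algebraMap_eq fun _ => rfl
  have : IsScalarTower K Ks Ω := IsScalarTower.of_algebraMap_eq fun _ => rfl
  let V : Fin n → ClosedSubgroup Gal(Ω/F) := fun i =>
    { (Φ.toMonoidHom.comp (ι i).toMonoidHom).range with
      isClosed' := by
        change IsClosed ((Φ.toMonoidHom.comp (ι i).toMonoidHom).range : Set Gal(Ω/F))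
        rw [MonoidHom.coe_range]
        exact (isCompact_range
          (Φ.continuous_toFun.comp (ι i).continuous_toFun)).isClosed }
  let Fi : Fin n → IntermediateField F Ω := fun i => IntermediateField.fixedField (V i).1
  have hfix : ∀ i, (Fi i).fixingSubgroup = (Φ.toMonoidHom.comp (ι i).toMonoidHom).range :=
    fun i => InfiniteGalois.fixingSubgroup_fixedField (V i)
  have hfree : IsProfiniteFreeProduct (fun i => (Fi i).fixingSubgroup) :=
    isProfiniteFreeProduct_of_bijective Φ hΦ _ hfix
  -- θ acts on `Ks` through π, and π is the inclusion on each factor; bijectivity of restriction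
  -- follows at once.
  have hres : ∀ i (g : absGal Ki i), absGalRes K Ks F Ω (Φ (ι i g)) = g := by
    intro i g
    ext x
    apply (algebraMap Ks Ω).injective
    rw [algebraMap_absGalRes, hΦθ]
    change θ _ (κ x) = κ _
    rw [hθκ, hπ]
  refine ⟨F, Ω, inferInstance, inferInstance, inferInstance, hF, inferInstance, inferInstance,
    inferInstance, inferInstance, inferInstance, Fi, ?_, fun i => inferInstance, ?_, ?_, ?_, hfree⟩
  · refine le_antisymm ((Cardinal.mk_le_of_injective Subtype.val_injective).trans hcard)
      (max_le ?_ (Cardinal.mk_le_of_injective (algebraMap K F).injective))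
    have : Infinite F := Infinite.of_injective
      (fun m : ℕ => (⟨t, (mem_fixedSubfield θ).2 ht⟩ : F) ^ m)
      fun a b hab => htinj (congrArg Subtype.val hab)
    exact Cardinal.aleph0_le_mk F
  · rw [eq_bot_iff]
    intro x hx
    rw [InfiniteGalois.mem_bot_iff_fixed]
    -- An element of every `Fi i` has an open, hence closed, stabilizer containing all factors, and
    -- these generate. This also covers `n = 0`, where the Galois group is trivial.
    have hle : (⨆ i, (Fi i).fixingSubgroup).topologicalClosure ≤
        MulAction.stabilizer Gal(Ω/F) x := by
      refine Subgroup.topologicalClosure_minimal _ (iSup_le fun i σ hσ => ?_)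
        (Subgroup.isClosed_of_isOpen _ (stabilizer_isOpen_of_isIntegral x))
      exact (IntermediateField.mem_fixingSubgroup_iff _ _).1 hσ x
        (iInf_le Fi i hx)
    rw [hfree.generate] at hle
    exact fun f => hle (Subgroup.mem_top f)
  · intro i x hx
    refine (IntermediateField.mem_fixedField_iff _ _).2 ?_
    rintro _ ⟨g, rfl⟩
    change Φ (ι i g) (κ x) = κ x
    rw [hΦθ, hθκ, hπ]
    exact congrArg κ ((IntermediateField.mem_fixingSubgroup_iff _ _).1 g.2 x hx)
  · intro i
    rw [hfix]
    refine ⟨?_, ?_, ?_⟩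
    · rintro _ ⟨g, rfl⟩
      change absGalRes K Ks F Ω (Φ (ι i g)) ∈ _
      rw [hres]
      exact g.2
    · rintro _ ⟨g, rfl⟩ _ ⟨g', rfl⟩ h
      change absGalRes K Ks F Ω (Φ (ι i g)) = absGalRes K Ks F Ω (Φ (ι i g')) at h
      rw [hres, hres] at h
      rw [Subtype.ext h]
    · intro g hg
      exact ⟨_, ⟨⟨g, hg⟩, rfl⟩, hres i ⟨g, hg⟩⟩
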